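/- **Setting.** Let $\mathbb C$ be a small category with a terminal object $\star$ and an initial object $0$ such that $|{-}|=\mathbb C(\star,-)$ is faithful. Let $J$ assign to every object $c$ a set $J(c)$ of *covering* families of maps with codomain $c$, such that: (C) if $\{f_i\}$ covers $c$ and $h:d\to c$, there is a cover $\{g_j\}$ of $d$ such that each $h\circ g_j$ factors through some $f_i$; ($\star$) covers are jointly surjective on points; ($0$) the empty family covers $0$; (M) each $\{1_c\}$ covers; (L) composites of covers are covers. So $(\mathbb C,J)$ is a *concrete site*. Let $\mathcal M$ be a *class of admissible monos*: for each $c$ a set $\mathcal M(c)$ of monos with codomain $c$ such that: $0\to c$ and all isomorphisms are in $\mathcal M$; $\mathcal M$ is closed under composition; all pullbacks of $\mathcal M$-maps exist and are in $\mathcal M$; for $m,m'\in\mathcal M(c)$, $\mathrm{Im}|m|\subseteq\mathrm{Im}|m'|$ implies $m\le m'$ as subobjects; for every increasing chain $m_n:c_n\rightarrowtail c$ in $\mathcal M(c)$ there is $m_\infty:c_\infty\rightarrowtail c$ in $\mathcal M(c)$ with $\mathrm{Im}|m_\infty|=\bigcup_n\mathrm{Im}|m_n|$, and $c_\infty$ has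 a cover each of whose members factors through one of the maps $c_n\rightarrowtail c_\infty$; and the presheaf $c\mapsto \mathrm{Sub}_{\mathcal M}(c)$ is a $J$-sheaf (equivalently: if $U\subseteq|c|$ and $\{f_i:c_i\to c\}$ covers $c$ and each $|f_i|^{-1}(U)$ is $\mathrm{Im}|m_i|$ for some $m_i\in\mathcal M(c_i)$, then $U=\mathrm{Im}|m|$ for some $m\in\mathcal M(c)$). An *$\omega$-concrete sheaf* $X$ is an $\omega$-cpo $|X|$ (a poset with suprema of increasing sequences) with, for every $c$, a set $R^c_X$ of functions $|c|\to|X|$ that contains the constants, is closed under precomposition with $|h|$ for $h:d\to c$ (from $R^c_X$ to $R^d_X$), contains every $g$ such that $g\circ|f_i|\in R^{c_i}_X$ for all members of some cover $\{f_i:c_i\to c\}$, and is closed under pointwise suprema of increasing sequences. A morphism $X\to Y$ is a continuous function $\alpha$ with $\alpha\circ g\in R^c_Y$ for all $g\in R^c_X$. This is the category $\omega\mathsf{Conc}(\mathbb C,J)$. The lifting $L_{\mathcal M}X$ is $|X|\uplus\{\bot\}$ with a new least element $\bot$; $g\in R^c_{L_{\mathcal M}X}$ iff there is $m:c'\rightarrowtail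 c$ in $\mathcal M(c)$ with $g^{-1}(|X|)=\mathrm{Im}|m|$ and $g\circ|m|\in R^{c'}_X$. Its strong monad structure is, on underlying sets, that of the monad $X\mapsto X\uplus\{\bot\}$. **Language.** $\mathsf{PCF_v}$ may be extended by type constants $\alpha$, each with a set $\mathrm{Val}_\alpha$, and by term constants $f:\alpha\to\beta$ between ground types, each with a partial function $\mathrm{Val}_\alpha\rightharpoonup\mathrm{Val}_\beta$; the *ground types* are $\mathsf{nat}$ (with $\mathrm{Val}_{\mathsf{nat}}=\mathbb N$, identified with the numerals) and the type constants. Types are the ground types and $\tau\to\tau'$. Values and computations are $$v,w::=x\mid \underline{0}\mid\mathsf{succ}(v)\mid c\ (c\in\mathrm{Val}_\alpha)\mid f\mid\mathsf{rec}\,f\,x.\,t,\qquad t::=v\,w\mid\mathsf{return}\,v\mid\mathsf{let}\,x=t\,\mathsf{in}\,t'\mid\mathsf{case}\,v\,\mathsf{of}\,\{\underline 0\to t\mid\mathsf{succ}(x)\to t'\},$$ with the usual simple typing; terms are considered with their typing derivations, as usual for a denotational semantics. Evaluation $t\Downarrow v$ is the least relation between closed computations and closed values with: $\mathsf{return}\,v\Downarrow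 v$; $(\mathsf{rec}\,f\,x.\,t)\,v\Downarrow w$ if $t[(\mathsf{rec}\,f\,x.\,t)/f,v/x]\Downarrow w$; $\mathsf{let}\,x=t\,\mathsf{in}\,t'\Downarrow w$ if $t\Downarrow v$ and $t'[v/x]\Downarrow w$ for some $v$; $\mathsf{case}\,\underline0\,\mathsf{of}\,\{\underline 0\to t\mid\mathsf{succ}(x)\to t'\}\Downarrow w$ if $t\Downarrow w$; $\mathsf{case}\,\mathsf{succ}(v)\,\mathsf{of}\,\{\underline 0\to t\mid\mathsf{succ}(x)\to t'\}\Downarrow w$ if $t'[v/x]\Downarrow w$; and $f\,v\Downarrow w$ if the partial function of $f$ is defined at $v$ with value $w$. **Model.** Let each $\mathrm{Val}_\alpha$ be given the structure of an $\omega$-concrete sheaf $[\![\alpha]\!]$ in such a way that the partial function of each term constant $f:\alpha\to\beta$ is a partial morphism, that is, a morphism $[\![\alpha]\!]\to L_{\mathcal M}[\![\beta]\!]$. Interpret $[\![\mathsf{nat}]\!]$ as $1+1+\cdots$ ($\mathbb N$ with the discrete order and the $J$-locally constant functions), $[\![\tau\to\tau']\!]$ as the exponential $[\![\tau]\!]\Rightarrow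 L_{\mathcal M}[\![\tau']\!]$ (morphisms with the pointwise order), contexts as products, values $\Gamma\vdash v:\tau$ as morphisms $[\![\Gamma]\!]\to[\![\tau]\!]$, and computations $\Gamma\vdash t:\tau$ as morphisms $[\![\Gamma]\!]\to L_{\mathcal M}[\![\tau]\!]$, in the standard way for a strong monad, with $\mathsf{rec}$ interpreted by the fixed point combinator $\varphi\mapsto\bigsqcup_n\varphi^n(\bot)$. **Theorem.** For all such data, this model is sound and adequate. That is, for a closed computation $t$ and a closed value $v$ of the same type $\tau$: * Soundness: if $t\Downarrow v$, then $[\![t]\!]=[\![\mathsf{return}\,v]\!]$. * Adequacy: if $\tau$ is a ground type and $[\![t]\!]=[\![\mathsf{return}\,v]\!]$, then $t\Downarrow v$. -/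

import Mathlib

open CategoryTheory CategoryTheory.Limits OmegaCompletePartialOrder

universe u v w a b

namespace OmegaPCF

/-! ### Concrete sites -/

/-- A concrete site: a category with a terminal object `star`, an initial object `zero`, faithful
global-points functor, and a coverage (families of maps with common codomain, stable in the sense of
the field `pullback` of `Coverage`) such that covers are surjective on points, `zero` is covered by
the empty family, identities cover, and covers compose. -/
structure ConcreteSite (C : Type u) [Category.{v} C] extends Coverage C where
  star : C
  starIsTerminal : IsTerminal star
  zero : C
  zeroIsInitial : IsInitial zero
  faithful : (coyoneda.obj (Opposite.op star)).Faithful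
  cover_points : ∀ (c : C), ∀ T ∈ coverings c, ∀ p : star ⟶ c,
    ∃ (d : C) (f : d ⟶ c), T f ∧ ∃ q : star ⟶ d, q ≫ f = p
  zero_cover : (⊥ : Presieve zero) ∈ coverings zero
  id_cover : ∀ c : C, Presieve.singleton (𝟙 c) ∈ coverings c
  comp_cover : ∀ (c : C), ∀ T ∈ coverings c,
    ∀ R : (∀ ⦃d : C⦄ ⦃f : d ⟶ c⦄, T f → Presieve d),
      (∀ ⦃d : C⦄ ⦃f : d ⟶ c⦄ (hf : T f), R hf ∈ coverings d) → T.bind R ∈ coverings c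

section Sites

variable {C : Type u} [Category.{v} C]

/-- The set `|c|` of points of `c`. -/
abbrev ConcreteSite.Pt (S : ConcreteSite C) (c : C) : Type v := S.star ⟶ c

/-- The function `|h| : |d| → |c|` induced by `h : d ⟶ c`. -/
def ConcreteSite.ptMap (S : ConcreteSite C) {d c : C} (h : d ⟶ c) : S.Pt d → S.Pt c :=
  fun p => p ≫ h

/-- `U ⊆ |c|` is the set of points of some `P`-subobject of `c`. -/
def ConcreteSite.IsPointSet (S : ConcreteSite C) (P : MorphismProperty C) {c : C}
    (U : Set (S.Pt c)) : Prop :=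
  ∃ (o : C) (m : o ⟶ c), P m ∧ Set.range (S.ptMap m) = U

/-- A class of admissible monos on a concrete site.  As subobjects in the class are determined by
their sets of points, `mem_local` says precisely that the presheaf of admissible subobjects is a
sheaf. -/
structure AdmissibleMonos (S : ConcreteSite C) where
  mem : MorphismProperty C
  mono : ∀ ⦃o c : C⦄ (m : o ⟶ c), mem m → Mono m
  zero_mem : ∀ c : C, mem (S.zeroIsInitial.to c)
  iso_mem : ∀ ⦃o c : C⦄ (m : o ⟶ c), IsIso m → mem m
  comp_mem : ∀ ⦃o' o c : C⦄ (f : o' ⟶ o) (g : o ⟶ c), mem f → mem g → mem (f ≫ g)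
  exists_pullback : ∀ ⦃o c d : C⦄ (m : o ⟶ c) (h : d ⟶ c), mem m →
    ∃ (e : C) (h' : e ⟶ o) (m' : e ⟶ d), IsPullback h' m' m h
  pullback_mem : ∀ ⦃e o d c : C⦄ (h' : e ⟶ o) (m' : e ⟶ d) (m : o ⟶ c) (h : d ⟶ c),
    IsPullback h' m' m h → mem m → mem m'
  order_reflecting : ∀ ⦃o o' c : C⦄ (m : o ⟶ c) (m' : o' ⟶ c), mem m → mem m' →
    Set.range (S.ptMap m) ⊆ Set.range (S.ptMap m') → ∃ k : o ⟶ o', k ≫ m' = m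
  chain_mem : ∀ ⦃c : C⦄ (o : ℕ → C) (m : ∀ n, o n ⟶ c), (∀ n, mem (m n)) →
    (∀ n, Set.range (S.ptMap (m n)) ⊆ Set.range (S.ptMap (m (n + 1)))) →
      S.IsPointSet mem (⋃ n, Set.range (S.ptMap (m n)))
  chain_cover : ∀ ⦃c : C⦄ (o : ℕ → C) (m : ∀ n, o n ⟶ c), (∀ n, mem (m n)) →
    (∀ n, Set.range (S.ptMap (m n)) ⊆ Set.range (S.ptMap (m (n + 1)))) →
    ∀ (o' : C) (m' : o' ⟶ c), mem m' →
      Set.range (S.ptMap m') = ⋃ n, Set.range (S.ptMap (m n)) →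
      ∃ T ∈ S.coverings o', ∀ ⦃d : C⦄ (f : d ⟶ o'), T f →
        ∃ (n : ℕ) (k : d ⟶ o n) (i : o n ⟶ o'), i ≫ m' = m n ∧ k ≫ i = f
  mem_local : ∀ ⦃c : C⦄, ∀ T ∈ S.coverings c, ∀ U : Set (S.Pt c),
    (∀ ⦃d : C⦄ (f : d ⟶ c), T f → S.IsPointSet mem (S.ptMap f ⁻¹' U)) → S.IsPointSet mem U

/-! ### ω-concrete sheaves -/

/-- A concrete sheaf structure on the set `X`; `IsPlot c g` means `g ∈ R^c_X`. -/
structure ConcreteSheafStr (S : ConcreteSite C) (X : Type w) where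
  IsPlot : ∀ c : C, (S.Pt c → X) → Prop
  const_plot : ∀ (c : C) (x : X), IsPlot c (fun _ => x)
  comp_plot : ∀ ⦃d c : C⦄ (h : d ⟶ c) (g : S.Pt c → X), IsPlot c g → IsPlot d (g ∘ S.ptMap h)
  glue_plot : ∀ (c : C) (g : S.Pt c → X), ∀ T ∈ S.coverings c,
    (∀ ⦃d : C⦄ (f : d ⟶ c), T f → IsPlot d (g ∘ S.ptMap f)) → IsPlot c g

/-- An ω-concrete sheaf structure on the set `X`. -/
structure OmegaConcStr (S : ConcreteSite C) (X : Type w) extends ConcreteSheafStr S X where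
  cpo : OmegaCompletePartialOrder X
  sup_plot : ∀ (c : C) (g : Chain (S.Pt c → X)), (∀ n, IsPlot c (g n)) → IsPlot c (ωSup g)

/-- An ω-concrete sheaf. -/
structure OmegaConc (S : ConcreteSite C) where
  carrier : Type w
  str : OmegaConcStr S carrier

end Sites

section Sheaves

variable {C : Type u} [Category.{v} C] {S : ConcreteSite C}

instance (X : OmegaConc.{u, v, w} S) : OmegaCompletePartialOrder X.carrier := X.str.cpo

/-- `f` is a morphism of ω-concrete sheaves. -/
structure IsHom (X Y : OmegaConc.{u, v, w} S) (f : X.carrier → Y.carrier) : Prop where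
  cont : ωScottContinuous f
  plot : ∀ (c : C) (g : S.Pt c → X.carrier), X.str.IsPlot c g → Y.str.IsPlot c (f ∘ g)

/-- Morphisms of ω-concrete sheaves. -/
@[ext]
structure Hom (X Y : OmegaConc.{u, v, w} S) where
  toFun : X.carrier → Y.carrier
  isHom : IsHom X Y toFun

theorem cont_of {X Y : Type*} [OmegaCompletePartialOrder X] [OmegaCompletePartialOrder Y]
    {f : X → Y} (hm : Monotone f)
    (h : ∀ (c : Chain X) (z : Y), (∀ n, f (c n) ≤ z) → f (ωSup c) ≤ z) : ωScottContinuous f :=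
  ωScottContinuous.of_monotone_map_ωSup ⟨hm, fun c =>
    le_antisymm (h c _ fun n => le_ωSup (c.map ⟨f, hm⟩) n)
      (ωSup_le _ _ fun n => hm (le_ωSup c n))⟩

theorem cont_le {X Y : Type*} [OmegaCompletePartialOrder X] [OmegaCompletePartialOrder Y]
    {f : X → Y} (hf : ωScottContinuous f) (c : Chain X) (z : Y) (h : ∀ n, f (c n) ≤ z) :
    f (ωSup c) ≤ z := by
  rw [hf.map_ωSup]
  exact ωSup_le _ _ h

namespace Hom

def comp {X Y Z : OmegaConc.{u, v, w} S} (g : Hom Y Z) (f : Hom X Y) : Hom X Z where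
  toFun := g.toFun ∘ f.toFun
  isHom := ⟨g.isHom.cont.comp f.isHom.cont, fun c p hp => g.isHom.plot c _ (f.isHom.plot c p hp)⟩

def id (X : OmegaConc.{u, v, w} S) : Hom X X where
  toFun := fun x => x
  isHom := ⟨ωScottContinuous.id, fun _ _ hp => hp⟩

def const (X : OmegaConc.{u, v, w} S) {Y : OmegaConc.{u, v, w} S} (y : Y.carrier) : Hom X Y where
  toFun := fun _ => y
  isHom := ⟨ωScottContinuous.const, fun c _ _ => Y.str.const_plot c y⟩

end Hom

/-! ### Finite products -/

/-- The terminal ω-concrete sheaf. -/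
def unitObj (S : ConcreteSite C) : OmegaConc.{u, v, w} S where
  carrier := PUnit
  str :=
    { IsPlot := fun _ _ => True
      const_plot := fun _ _ => trivial
      comp_plot := fun _ _ _ _ _ => trivial
      glue_plot := fun _ _ _ _ _ => trivial
      cpo :=
        { (inferInstance : PartialOrder PUnit) with
          ωSup := fun _ => PUnit.unit
          le_ωSup := fun _ _ => le_rfl
          ωSup_le := fun _ _ h => h 0 }
      sup_plot := fun _ _ _ => trivial }

/-- The product, with componentwise order and plots. -/
abbrev prodObj (X Y : OmegaConc.{u, v, w} S) : OmegaConc.{u, v, w} S where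
  carrier := X.carrier × Y.carrier
  str :=
    { IsPlot := fun c g =>
        X.str.IsPlot c (fun p => (g p).1) ∧ Y.str.IsPlot c (fun p => (g p).2)
      const_plot := fun c x => ⟨X.str.const_plot c x.1, Y.str.const_plot c x.2⟩
      comp_plot := fun _ _ h _ hg => ⟨X.str.comp_plot h _ hg.1, Y.str.comp_plot h _ hg.2⟩
      glue_plot := fun c _ T hT h =>
        ⟨X.str.glue_plot c _ T hT fun _ f hf => (h f hf).1,
          Y.str.glue_plot c _ T hT fun _ f hf => (h f hf).2⟩
      cpo := inferInstanceAs (OmegaCompletePartialOrder (X.carrier × Y.carrier))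
      sup_plot := fun c g hg =>
        ⟨X.str.sup_plot c (g.map ⟨fun k p => (k p).1, fun _ _ hk p => (hk p).1⟩) fun n => (hg n).1,
          Y.str.sup_plot c (g.map ⟨fun k p => (k p).2, fun _ _ hk p => (hk p).2⟩)
            fun n => (hg n).2⟩ }

namespace Hom

def fst (X Y : OmegaConc.{u, v, w} S) : Hom (prodObj X Y) X where
  toFun := Prod.fst
  isHom := ⟨Prod.ωScottContinuous_fst, fun _ _ hp => hp.1⟩

def snd (X Y : OmegaConc.{u, v, w} S) : Hom (prodObj X Y) Y where
  toFun := Prod.snd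
  isHom := ⟨Prod.ωScottContinuous_snd, fun _ _ hp => hp.2⟩

def pair {Z X Y : OmegaConc.{u, v, w} S} (f : Hom Z X) (g : Hom Z Y) : Hom Z (prodObj X Y) where
  toFun := fun z => (f.toFun z, g.toFun z)
  isHom := ⟨Prod.ωScottContinuous.prodMk f.isHom.cont g.isHom.cont,
    fun c p hp => ⟨f.isHom.plot c p hp, g.isHom.plot c p hp⟩⟩

end Hom

/-! ### Exponentials -/

instance (X Y : OmegaConc.{u, v, w} S) : PartialOrder (Hom X Y) where
  le f g := ∀ x, f.toFun x ≤ g.toFun x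
  le_refl _ _ := le_rfl
  le_trans _ _ _ h h' x := (h x).trans (h' x)
  le_antisymm _ _ h h' := Hom.ext (funext fun x => le_antisymm (h x) (h' x))

/-- Evaluation at a point, as a monotone map. -/
def Hom.evalAt {X Y : OmegaConc.{u, v, w} S} (x : X.carrier) : Hom X Y →o Y.carrier :=
  ⟨fun f => f.toFun x, fun _ _ h => h x⟩

/-- Pointwise suprema of morphisms. -/
instance (X Y : OmegaConc.{u, v, w} S) : OmegaCompletePartialOrder (Hom X Y) where
  ωSup F :=
    { toFun := fun x => ωSup (F.map (Hom.evalAt x))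
      isHom :=
        { cont := by
            apply cont_of
            · intro x y hxy
              exact ωSup_le _ _ fun n =>
                ((F n).isHom.cont.monotone hxy).trans (le_ωSup (F.map (Hom.evalAt y)) n)
            · intro c z h
              refine ωSup_le _ _ fun n => ?_
              exact cont_le (F n).isHom.cont c z fun k =>
                (le_ωSup (F.map (Hom.evalAt (c k))) n).trans (h k)
          plot := fun c g hg =>
            Y.str.sup_plot c (F.map ⟨fun f => f.toFun ∘ g, fun _ _ h p => h (g p)⟩)
              fun n => (F n).isHom.plot c g hg } }
  le_ωSup F n x := le_ωSup (F.map (Hom.evalAt x)) n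
  ωSup_le _ _ h x := ωSup_le _ _ fun n => h n x

/-- The exponential `X ⇒ Y`. -/
abbrev expObj (X Y : OmegaConc.{u, v, w} S) : OmegaConc.{u, v, w} S where
  carrier := Hom X Y
  str :=
    { IsPlot := fun c f => ∀ ⦃d : C⦄ (h : d ⟶ c) (g : S.Pt d → X.carrier), X.str.IsPlot d g →
        Y.str.IsPlot d (fun p => (f (S.ptMap h p)).toFun (g p))
      const_plot := fun _ φ d _ g hg => φ.isHom.plot d g hg
      comp_plot := by
        intro d c h f hf e k g hg
        have := hf (k ≫ h) g hg
        simpa [ConcreteSite.ptMap] using this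
      glue_plot := by
        intro c f T hT hf d h g hg
        obtain ⟨R, hR, hfac⟩ := S.pullback h T hT
        refine Y.str.glue_plot d _ R hR ?_
        intro e r hr
        obtain ⟨c', k, t, ht, hkt⟩ := hfac hr
        have := hf t ht k (g ∘ S.ptMap r) (X.str.comp_plot r g hg)
        have e1 : ∀ p : S.Pt e, S.ptMap t (S.ptMap k p) = S.ptMap h (S.ptMap r p) := by
          intro p
          simp [ConcreteSite.ptMap, hkt]
        simpa [Function.comp_def, e1] using this
      cpo := inferInstance
      sup_plot := fun c F hF d h g hg =>
        Y.str.sup_plot d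
          (F.map ⟨fun k p => (k (S.ptMap h p)).toFun (g p), fun _ _ hk p => hk _ (g p)⟩)
          fun n => hF n h g hg }

namespace Hom

def eval (X Y : OmegaConc.{u, v, w} S) : Hom (prodObj (expObj X Y) X) Y where
  toFun := fun z => Hom.toFun z.1 z.2
  isHom :=
    { cont := by
        apply cont_of
        · rintro ⟨f, x⟩ ⟨f', x'⟩ ⟨h, h'⟩
          exact (f.isHom.cont.monotone h').trans (h x')
        · intro c z h
          refine ωSup_le _ _ fun n => ?_
          refine cont_le (c n).1.isHom.cont (c.map OrderHom.snd) z fun k => ?_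
          have h1 : (c n).1 ≤ (c (max n k)).1 := (c.monotone (le_max_left n k)).1
          have h2 : (c k).2 ≤ (c (max n k)).2 := (c.monotone (le_max_right n k)).2
          exact ((c n).1.isHom.cont.monotone h2).trans ((h1 _).trans (h (max n k)))
      plot := by
        rintro c g ⟨h1, h2⟩
        have := h1 (𝟙 c) _ h2
        simpa [ConcreteSite.ptMap, Function.comp_def] using this }

def curry {Z X Y : OmegaConc.{u, v, w} S} (f : Hom (prodObj Z X) Y) : Hom Z (expObj X Y) where
  toFun := fun z =>
    { toFun := fun x => f.toFun (z, x)
      isHom := (f.comp (pair (const X z) (Hom.id X))).isHom }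
  isHom :=
    { cont := by
        apply cont_of
        · intro z z' h x
          exact f.isHom.cont.monotone ⟨h, le_rfl⟩
        · intro c φ h x
          exact cont_le (f.comp (pair (Hom.id Z) (const Z x))).isHom.cont c (φ.toFun x)
            fun n => h n x
      plot := fun c g hg d h k hk => f.isHom.plot d (fun p => (g (S.ptMap h p), k p))
        ⟨Z.str.comp_plot h g hg, hk⟩ }

end Hom

/-! ### The natural numbers object -/

/-- The discrete order on `X`. -/
@[reducible]
def discreteOrder (X : Type w) : PartialOrder X where
  le := fun x y => x = y
  lt := fun _ _ => False
  lt_iff_le_not_ge := fun _ _ => ⟨False.elim, fun h => h.2 h.1.symm⟩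
  le_refl := fun _ => rfl
  le_trans := fun _ _ _ h h' => h.trans h'
  le_antisymm := fun _ _ h _ => h

@[reducible]
def discreteCpo (X : Type w) : OmegaCompletePartialOrder X :=
  letI := discreteOrder X
  { ωSup := fun c => c 0
    le_ωSup := fun c n => (c.monotone (Nat.zero_le n)).symm
    ωSup_le := fun _ _ h => h 0 }

/-- The coproduct `1 + 1 + ...` of countably many copies of `1`: the natural numbers with the
discrete order and the `J`-locally constant functions as plots. -/
def natObj (S : ConcreteSite C) : OmegaConc.{u, v, w} S where
  carrier := ULift.{w} ℕ
  str :=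
    { IsPlot := fun c g => ∃ T ∈ S.coverings c, ∀ ⦃d : C⦄ (f : d ⟶ c), T f →
        ∃ k : ULift.{w} ℕ, ∀ p : S.Pt d, g (S.ptMap f p) = k
      const_plot := fun c x => ⟨_, S.id_cover c, fun _ _ _ => ⟨x, fun _ => rfl⟩⟩
      comp_plot := by
        rintro d c h g ⟨T, hT, hg⟩
        obtain ⟨R, hR, hfac⟩ := S.pullback h T hT
        refine ⟨R, hR, fun e r hr => ?_⟩
        obtain ⟨c', i, t, ht, hit⟩ := hfac hr
        obtain ⟨k, hk⟩ := hg t ht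
        refine ⟨k, fun p => ?_⟩
        rw [← hk (S.ptMap i p)]
        simp [ConcreteSite.ptMap, hit]
      glue_plot := by
        intro c g T hT h
        choose R hR hg using h
        refine ⟨T.bind fun d f hf => R f hf, S.comp_cover c T hT _ fun d f hf => hR f hf, ?_⟩
        rintro e _ ⟨d, r, f, hf, hr, rfl⟩
        obtain ⟨k, hk⟩ := hg f hf r hr
        refine ⟨k, fun p => ?_⟩
        rw [← hk p]
        simp [ConcreteSite.ptMap]
      cpo := discreteCpo _
      sup_plot := fun _ _ h => h 0 }

theorem natObj_cont {Y : Type*} [OmegaCompletePartialOrder Y]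
    (f : (natObj.{u, v, w} S).carrier → Y) : ωScottContinuous f := by
  apply cont_of
  · intro m n h
    have h : m = n := h
    rw [h]
  · intro c z h
    exact h 0

namespace Hom

def succ (S : ConcreteSite C) : Hom (natObj.{u, v, w} S) (natObj.{u, v, w} S) where
  toFun := fun n => ULift.up (ULift.down.{w} n + 1)
  isHom :=
    { cont := natObj_cont _
      plot := by
        rintro c g ⟨T, hT, h⟩
        refine ⟨T, hT, fun d f hf => ?_⟩
        obtain ⟨k, hk⟩ := h f hf
        exact ⟨ULift.up (k.down + 1), fun p =>
          congrArg (fun n : ULift.{w} ℕ => ULift.up.{w} (n.down + 1)) (hk p)⟩ }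

/-- Case distinction on a natural number. -/
def natCaseFun {Z Y : OmegaConc.{u, v, w} S} (f : Hom Z Y) (g : Hom (prodObj Z (natObj S)) Y)
    (z : Z.carrier) (n : ULift.{w} ℕ) : Y.carrier :=
  match n with
  | ⟨0⟩ => f.toFun z
  | ⟨n + 1⟩ => g.toFun (z, ULift.up.{w} n)

theorem natCaseFun_isHom {Z Y : OmegaConc.{u, v, w} S} (f : Hom Z Y)
    (g : Hom (prodObj Z (natObj S)) Y) (n : ULift.{w} ℕ) :
    IsHom Z Y (fun z => natCaseFun f g z n) := by
  obtain ⟨n⟩ := n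
  cases n with
  | zero => exact f.isHom
  | succ n => exact (g.comp (pair (Hom.id Z) (const Z (Y := natObj S) (ULift.up.{w} n)))).isHom

def natCase {Z Y : OmegaConc.{u, v, w} S} (f : Hom Z Y) (g : Hom (prodObj Z (natObj S)) Y) :
    Hom (prodObj Z (natObj S)) Y where
  toFun := fun z => natCaseFun f g z.1 z.2
  isHom :=
    { cont := by
        apply cont_of
        · rintro ⟨z, n⟩ ⟨z', n'⟩ ⟨h, h'⟩
          have h' : n = n' := h'
          subst h'
          exact (natCaseFun_isHom f g n).cont.monotone h
        · intro c z h
          have hc : ∀ n, (c n).2 = (c 0).2 := fun n => ((c.monotone (Nat.zero_le n)).2 : _ = _).symm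
          refine cont_le (natCaseFun_isHom f g (c 0).2).cont (c.map OrderHom.fst) z fun n => ?_
          exact (congrArg (natCaseFun f g (c n).1) (hc n)).ge.trans (h n)
      plot := by
        rintro c k ⟨h1, T, hT, h2⟩
        refine Y.str.glue_plot c _ T hT fun d t ht => ?_
        obtain ⟨n, hn⟩ := h2 t ht
        refine (congrArg (Y.str.IsPlot d) (funext fun p => ?_)).mp
          ((natCaseFun_isHom f g n).plot d _ (Z.str.comp_plot t _ h1))
        exact (congrArg (natCaseFun f g (k (S.ptMap t p)).1) (hn p)).symm }

end Hom

end Sheaves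

/-! ### The lifting monad -/

section LiftCpo

variable {X : Type w} [OmegaCompletePartialOrder X]

/-- The tail of a chain in `X ⊎ {⊥}` from an index where it is not `⊥`. -/
def liftTail (c : Chain (WithBot X)) (n : ℕ) (hn : c n ≠ ⊥) : Chain X :=
  ⟨⟨fun k => (c (n + k)).unbot (ne_bot_of_le_ne_bot hn (c.monotone (Nat.le_add_right n k))),
    fun i j h => by
      rw [← WithBot.coe_le_coe, WithBot.coe_unbot, WithBot.coe_unbot]
      exact c.monotone (Nat.add_le_add_left h n)⟩⟩

theorem coe_liftTail (c : Chain (WithBot X)) (n : ℕ) (hn : c n ≠ ⊥) (k : ℕ) :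
    (liftTail c n hn k : WithBot X) = c (n + k) := WithBot.coe_unbot _ _

open Classical in
/-- `X ⊎ {⊥}` is an ω-cpo. -/
noncomputable instance liftCpo : OmegaCompletePartialOrder (WithBot X) where
  ωSup c := if h : ∃ n, c n ≠ ⊥ then (ωSup (liftTail c h.choose h.choose_spec) : X) else ⊥
  le_ωSup c i := by
    split_ifs with h
    · refine (c.monotone (Nat.le_add_left i h.choose)).trans ?_
      change c (h.choose + i) ≤ _
      rw [← coe_liftTail c _ h.choose_spec, WithBot.coe_le_coe]
      exact le_ωSup _ i
    · push Not at h
      rw [h i]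
  ωSup_le c z hz := by
    split_ifs with h
    · obtain ⟨z, rfl⟩ := WithBot.ne_bot_iff_exists.mp
        (ne_bot_of_le_ne_bot h.choose_spec (hz h.choose))
      rw [WithBot.coe_le_coe]
      refine ωSup_le _ _ fun k => ?_
      rw [← WithBot.coe_le_coe, coe_liftTail]
      exact hz _
    · exact bot_le

theorem lift_sup_eq (c : Chain (WithBot X)) (n : ℕ) (hn : c n ≠ ⊥) :
    ωSup c = (ωSup (liftTail c n hn) : X) := by
  apply le_antisymm
  · refine ωSup_le _ _ fun k => (c.monotone (Nat.le_add_left k n)).trans ?_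
    change c (n + k) ≤ _
    rw [← coe_liftTail c n hn, WithBot.coe_le_coe]
    exact le_ωSup _ k
  · obtain ⟨z, hz⟩ := WithBot.ne_bot_iff_exists.mp (ne_bot_of_le_ne_bot hn (le_ωSup c n))
    rw [← hz, WithBot.coe_le_coe]
    refine ωSup_le _ _ fun k => ?_
    rw [← WithBot.coe_le_coe, coe_liftTail, hz]
    exact le_ωSup c _

theorem lift_sup_bot (c : Chain (WithBot X)) (h : ∀ n, c n = ⊥) : ωSup c = ⊥ :=
  le_bot_iff.mp (ωSup_le _ _ fun n => (h n).le)

theorem lift_sup_ne_bot (c : Chain (WithBot X)) : ωSup c ≠ ⊥ ↔ ∃ n, c n ≠ ⊥ := by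
  constructor
  · intro h
    by_contra! h'
    exact h (lift_sup_bot c h')
  · rintro ⟨n, hn⟩
    exact ne_bot_of_le_ne_bot hn (le_ωSup c n)

end LiftCpo

section Lifting

variable {C : Type u} [Category.{v} C] {S : ConcreteSite C}

/-- The plots of the lifting of `X`: partial functions whose domain is the set of points of an
admissible mono, and whose restriction to it is a plot of `X`. -/
def LiftPlot (M : AdmissibleMonos S) (X : OmegaConc.{u, v, w} S) (c : C)
    (g : S.Pt c → WithBot X.carrier) : Prop :=
  ∃ (o : C) (m : o ⟶ c), M.mem m ∧ {p | g p ≠ ⊥} = Set.range (S.ptMap m) ∧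
    ∃ g' : S.Pt o → X.carrier, X.str.IsPlot o g' ∧ ∀ q, g (S.ptMap m q) = (g' q : WithBot X.carrier)

variable (M : AdmissibleMonos S)

theorem LiftPlot.of_plot {X : OmegaConc.{u, v, w} S} {c : C} {g : S.Pt c → X.carrier}
    (hg : X.str.IsPlot c g) : LiftPlot M X c (fun p => (g p : WithBot X.carrier)) := by
  refine ⟨c, 𝟙 c, M.iso_mem _ inferInstance, ?_, g, hg, fun q => ?_⟩
  · ext p
    simp [ConcreteSite.ptMap]
  · simp [ConcreteSite.ptMap]

variable {M}

theorem LiftPlot.total {X : OmegaConc.{u, v, w} S} {c : C} {g : S.Pt c → X.carrier}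
    (h : LiftPlot M X c (fun p => (g p : WithBot X.carrier))) : X.str.IsPlot c g := by
  obtain ⟨o, m, hm, hdom, g', hg', he⟩ := h
  have hr : Set.range (S.ptMap (𝟙 c)) ⊆ Set.range (S.ptMap m) := by
    rw [← hdom]
    intro p _
    simp
  obtain ⟨k, hk⟩ := M.order_reflecting _ _ (M.iso_mem (𝟙 c) inferInstance) hm hr
  have := X.str.comp_plot k g' hg'
  convert this using 1
  funext p
  have h1 := he (S.ptMap k p)
  have h2 : S.ptMap m (S.ptMap k p) = p := by simp [ConcreteSite.ptMap, hk]
  rw [h2] at h1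
  exact WithBot.coe_injective h1

theorem range_ptMap_of_isPullback {e o d c : C} {h' : e ⟶ o} {m' : e ⟶ d} {m : o ⟶ c} {h : d ⟶ c}
    (hp : IsPullback h' m' m h) :
    Set.range (S.ptMap m') = S.ptMap h ⁻¹' Set.range (S.ptMap m) := by
  ext p
  constructor
  · rintro ⟨q, rfl⟩
    exact ⟨S.ptMap h' q, by simp [ConcreteSite.ptMap, hp.w]⟩
  · rintro ⟨q, hq⟩
    exact ⟨hp.lift q p hq, hp.lift_snd _ _ _⟩

theorem LiftPlot.comp {X : OmegaConc.{u, v, w} S} {d c : C} (h : d ⟶ c)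
    {g : S.Pt c → WithBot X.carrier} (hg : LiftPlot M X c g) : LiftPlot M X d (g ∘ S.ptMap h) := by
  obtain ⟨o, m, hm, hdom, g', hg', he⟩ := hg
  obtain ⟨e, h', m', hp⟩ := M.exists_pullback m h hm
  refine ⟨e, m', M.pullback_mem _ _ _ _ hp hm, ?_, g' ∘ S.ptMap h', X.str.comp_plot h' g' hg', ?_⟩
  · rw [range_ptMap_of_isPullback hp, ← hdom]
    rfl
  · intro q
    have : S.ptMap h (S.ptMap m' q) = S.ptMap m (S.ptMap h' q) := by
      simp [ConcreteSite.ptMap, hp.w]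
    simp only [Function.comp_apply]
    rw [this, he]

/-- A function is a plot of the lifting as soon as its domain is admissible and its restriction to
the domain is one locally. -/
theorem LiftPlot.of_cover {X : OmegaConc.{u, v, w} S} {c : C} {g : S.Pt c → WithBot X.carrier}
    {o : C} (m : o ⟶ c) (hm : M.mem m) (hdom : {p | g p ≠ ⊥} = Set.range (S.ptMap m))
    (T : Presieve o) (hT : T ∈ S.coverings o)
    (h : ∀ ⦃d : C⦄ (f : d ⟶ o), T f → LiftPlot M X d (fun p => g (S.ptMap m (S.ptMap f p)))) :
    LiftPlot M X c g := by
  have hne : ∀ q, g (S.ptMap m q) ≠ ⊥ := fun q => by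
    have : S.ptMap m q ∈ {p | g p ≠ ⊥} := by
      rw [hdom]
      exact ⟨q, rfl⟩
    exact this
  refine ⟨o, m, hm, hdom, fun q => (g (S.ptMap m q)).unbot (hne q), ?_,
    fun q => (WithBot.coe_unbot _ _).symm⟩
  refine X.str.glue_plot o _ T hT fun d f hf => ?_
  apply LiftPlot.total (M := M)
  refine (congrArg (LiftPlot M X d) (funext fun p => ?_)).mp (h f hf)
  exact (WithBot.coe_unbot _ _).symm

/-- The lifting `L_M X`. -/
noncomputable abbrev liftObj (M : AdmissibleMonos S) (X : OmegaConc.{u, v, w} S) :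
    OmegaConc.{u, v, w} S where
  carrier := WithBot X.carrier
  str :=
    { IsPlot := LiftPlot M X
      const_plot := by
        intro c x
        induction x using WithBot.recBotCoe with
        | bot =>
          have hempty : ∀ p : S.Pt S.zero, False := fun p => by
            obtain ⟨_, _, hf, _⟩ := S.cover_points S.zero ⊥ S.zero_cover p
            exact hf
          refine ⟨S.zero, S.zeroIsInitial.to c, M.zero_mem c, ?_, fun p => (hempty p).elim,
            X.str.glue_plot _ _ ⊥ S.zero_cover fun _ _ hf => hf.elim, fun p => (hempty p).elim⟩
          ext p
          simp only [ne_eq, not_true_eq_false, Set.mem_ofPred_eq, false_iff]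
          rintro ⟨q, _⟩
          exact hempty q
        | coe x => exact LiftPlot.of_plot M (X.str.const_plot c x)
      comp_plot := fun _ _ h _ hg => hg.comp h
      glue_plot := by
        intro c g T hT h
        obtain ⟨o, m, hm, hdom⟩ := M.mem_local T hT {p | g p ≠ ⊥} fun d f hf => by
          obtain ⟨o, m, hm, hdom, _⟩ := h f hf
          exact ⟨o, m, hm, hdom.symm⟩
        obtain ⟨R, hR, hfac⟩ := S.pullback m T hT
        refine LiftPlot.of_cover m hm hdom.symm R hR fun d f hf => ?_
        obtain ⟨c', k, t, ht, hkt⟩ := hfac hf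
        refine (congrArg (LiftPlot M X d) (funext fun p => ?_)).mp ((h t ht).comp k)
        simp [ConcreteSite.ptMap, hkt]
      cpo := liftCpo
      sup_plot := by
        intro c g hg
        choose o m hm hdom g' hg' he using hg
        have hmono : ∀ n k, Set.range (S.ptMap (m n)) ⊆ Set.range (S.ptMap (m (n + k))) := by
          intro n k
          rw [← hdom, ← hdom]
          intro p hp
          exact ne_bot_of_le_ne_bot hp (g.monotone (Nat.le_add_right n k) p)
        obtain ⟨o', m', hm', hu⟩ := M.chain_mem o m hm fun n => hmono n 1
        obtain ⟨T, hT, hcov⟩ := M.chain_cover o m hm (fun n => hmono n 1) o' m' hm' hu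
        refine LiftPlot.of_cover m' hm' ?_ T hT fun d f hf => ?_
        · rw [hu]
          ext p
          rw [Set.mem_iUnion]
          refine (lift_sup_ne_bot (g.map (Pi.evalOrderHom p))).trans (exists_congr fun n => ?_)
          rw [← hdom n]
          rfl
        · obtain ⟨n, k, i, hi, rfl⟩ := hcov f hf
          have hpt : ∀ p : S.Pt d, S.ptMap m' (S.ptMap (k ≫ i) p) = S.ptMap (m n) (S.ptMap k p) := by
            intro p
            simp [ConcreteSite.ptMap, hi]
          have hne : ∀ p : S.Pt d, g n (S.ptMap m' (S.ptMap (k ≫ i) p)) ≠ ⊥ := by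
            intro p
            rw [hpt, he]
            exact WithBot.coe_ne_bot
          let G : Chain (S.Pt d → X.carrier) :=
            ⟨⟨fun j p => liftTail (g.map (Pi.evalOrderHom (S.ptMap m' (S.ptMap (k ≫ i) p)))) n
              (hne p) j, fun j j' hj p => (liftTail _ n (hne p)).monotone hj⟩⟩
          have hG : ∀ j, X.str.IsPlot d (G j) := by
            intro j
            apply LiftPlot.total (M := M)
            have h1 : LiftPlot M X c (g (n + j)) := ⟨_, _, hm _, hdom _, _, hg' _, he _⟩
            refine (congrArg (LiftPlot M X d) (funext fun p => ?_)).mp (h1.comp ((k ≫ i) ≫ m'))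
            refine Eq.trans ?_ (coe_liftTail _ n (hne p) j).symm
            simp [ConcreteSite.ptMap]
          refine (congrArg (LiftPlot M X d) (funext fun p => ?_)).mp
            (LiftPlot.of_plot M (X.str.sup_plot d G hG))
          exact (lift_sup_eq (g.map (Pi.evalOrderHom _)) n (hne p)).symm }

namespace Hom

/-- The unit of the lifting monad. -/
noncomputable def unit (M : AdmissibleMonos S) (X : OmegaConc.{u, v, w} S) : Hom X (liftObj M X) where
  toFun := fun x => (WithBot.some x : WithBot X.carrier)
  isHom :=
    { cont := by
        apply cont_of
        · intro x y h
          exact WithBot.coe_le_coe.mpr h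
        · intro c z h
          obtain ⟨z', rfl⟩ := WithBot.ne_bot_iff_exists.mp
            (ne_bot_of_le_ne_bot WithBot.coe_ne_bot (h 0))
          exact WithBot.coe_le_coe.mpr (ωSup_le _ _ fun n => WithBot.coe_le_coe.mp (h n))
      plot := fun _ _ hg => LiftPlot.of_plot M hg }

/-- The functorial action of the lifting monad. -/
noncomputable def lmap (M : AdmissibleMonos S) {X Y : OmegaConc.{u, v, w} S} (f : Hom X Y) :
    Hom (liftObj M X) (liftObj M Y) where
  toFun := fun x => WithBot.map f.toFun x
  isHom :=
    { cont := by
        apply cont_of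
        · exact WithBot.monotone_map_iff.mpr f.isHom.cont.monotone
        · intro c z h
          by_cases hb : ∃ n, c n ≠ (⊥ : WithBot X.carrier)
          · obtain ⟨n, hn⟩ := hb
            have hk : ∀ k, ((f.toFun (liftTail c n hn k) : Y.carrier) : WithBot Y.carrier) ≤ z := by
              intro k
              have := h (n + k)
              rw [← coe_liftTail c n hn k] at this
              exact this
            obtain ⟨z', rfl⟩ := WithBot.ne_bot_iff_exists.mp
              (ne_bot_of_le_ne_bot WithBot.coe_ne_bot (hk 0))
            refine (congrArg (WithBot.map f.toFun) (lift_sup_eq c n hn)).le.trans ?_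
            rw [WithBot.map_coe]
            exact WithBot.coe_le_coe.mpr (cont_le f.isHom.cont _ z'
              fun k => WithBot.coe_le_coe.mp (hk k))
          · push Not at hb
            exact (congrArg (WithBot.map f.toFun) (lift_sup_bot c hb)).le.trans bot_le
      plot := by
        rintro c g ⟨o, m, hm, hdom, g', hg', he⟩
        refine ⟨o, m, hm, ?_, f.toFun ∘ g', f.isHom.plot o g' hg', fun q => ?_⟩
        · rw [← hdom]
          ext p
          exact not_congr WithBot.map_eq_bot_iff
        · simp only [Function.comp_apply]
          rw [he]
          rfl }

/-- The multiplication of the lifting monad. -/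
noncomputable def mul (M : AdmissibleMonos S) (X : OmegaConc.{u, v, w} S) :
    Hom (liftObj M (liftObj M X)) (liftObj M X) where
  toFun := fun x => WithBot.recBotCoe (C := fun _ => WithBot X.carrier) ⊥ (fun y => y) x
  isHom :=
    { cont := by
        apply cont_of
        · intro x y h
          induction x using WithBot.recBotCoe with
          | bot => exact bot_le
          | coe x =>
            obtain ⟨y, rfl⟩ := WithBot.ne_bot_iff_exists.mp
              (ne_bot_of_le_ne_bot WithBot.coe_ne_bot h)
            exact WithBot.coe_le_coe.mp h
        · intro c z h
          by_cases hb : ∃ n, c n ≠ (⊥ : WithBot (WithBot X.carrier))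
          · obtain ⟨n, hn⟩ := hb
            refine (congrArg (WithBot.recBotCoe (C := fun _ => WithBot X.carrier) ⊥ (fun y => y))
              (lift_sup_eq (X := WithBot X.carrier) c n hn)).le.trans ?_
            refine ωSup_le (liftTail (X := WithBot X.carrier) c n hn) z fun k => ?_
            have := h (n + k)
            rw [← coe_liftTail (X := WithBot X.carrier) c n hn k] at this
            exact this
          · push Not at hb
            exact (congrArg (WithBot.recBotCoe (C := fun _ => WithBot X.carrier) ⊥ (fun y => y))
              (lift_sup_bot (X := WithBot X.carrier) c hb)).le.trans bot_le
      plot := by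
        rintro c g ⟨o, m, hm, hdom, g', ⟨o', m', hm', hdom', g'', hg'', he'⟩, he⟩
        refine ⟨o', m' ≫ m, M.comp_mem _ _ hm' hm, ?_, g'', hg'', fun q => ?_⟩
        · ext p
          simp only [Function.comp_apply, ne_eq, Set.mem_ofPred_eq, Set.mem_range]
          constructor
          · intro hp
            have h1 : p ∈ {p | g p ≠ (⊥ : WithBot (WithBot X.carrier))} := by
              intro h0
              rw [h0] at hp
              exact hp rfl
            rw [hdom] at h1
            obtain ⟨q, rfl⟩ := h1
            rw [he] at hp
            have h2 : q ∈ {p | g' p ≠ (⊥ : WithBot X.carrier)} := hp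
            rw [hdom'] at h2
            obtain ⟨r, rfl⟩ := h2
            exact ⟨r, by simp [ConcreteSite.ptMap]⟩
          · rintro ⟨r, rfl⟩
            have : S.ptMap (m' ≫ m) r = S.ptMap m (S.ptMap m' r) := by simp [ConcreteSite.ptMap]
            rw [this, he, WithBot.recBotCoe_coe, he']
            exact WithBot.coe_ne_bot
        · have : S.ptMap (m' ≫ m) q = S.ptMap m (S.ptMap m' q) := by simp [ConcreteSite.ptMap]
          simp only [Function.comp_apply]
          rw [this, he, WithBot.recBotCoe_coe, he'] }

/-- The strength of the lifting monad. -/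
noncomputable def strength (M : AdmissibleMonos S) (X Y : OmegaConc.{u, v, w} S) :
    Hom (prodObj X (liftObj M Y)) (liftObj M (prodObj X Y)) where
  toFun := fun z => WithBot.map (fun y => (z.1, y)) z.2
  isHom :=
    { cont := by
        apply cont_of
        · rintro ⟨x, y⟩ ⟨x', y'⟩ ⟨h, h'⟩
          induction y using WithBot.recBotCoe with
          | bot => exact bot_le
          | coe y =>
            obtain ⟨y', rfl⟩ := WithBot.ne_bot_iff_exists.mp
              (ne_bot_of_le_ne_bot WithBot.coe_ne_bot h')
            exact WithBot.coe_le_coe.mpr ⟨h, WithBot.coe_le_coe.mp h'⟩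
        · intro c z h
          set c2 : Chain (WithBot Y.carrier) := c.map OrderHom.snd with hc2
          by_cases hb : ∃ n, c2 n ≠ (⊥ : WithBot Y.carrier)
          · obtain ⟨n, hn⟩ := hb
            have hk : ∀ k, ((((c (n + k)).1, liftTail c2 n hn k) : X.carrier × Y.carrier) :
                WithBot (X.carrier × Y.carrier)) ≤ z := by
              intro k
              refine le_trans (le_of_eq ?_) (h (n + k))
              have h3 : (c (n + k)).2 = ((liftTail c2 n hn k : Y.carrier) : WithBot Y.carrier) :=
                (coe_liftTail c2 n hn k).symm
              rw [h3]
              rfl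
            obtain ⟨z', rfl⟩ := WithBot.ne_bot_iff_exists.mp
              (ne_bot_of_le_ne_bot WithBot.coe_ne_bot (hk 0))
            refine (congrArg (WithBot.map fun y => ((ωSup c).1, y))
              (lift_sup_eq c2 n hn)).le.trans ?_
            rw [WithBot.map_coe]
            refine WithBot.coe_le_coe.mpr ⟨ωSup_le _ _ fun k => ?_, ωSup_le _ _ fun k => ?_⟩
            · exact (c.monotone (Nat.le_add_left k n)).1.trans (WithBot.coe_le_coe.mp (hk k)).1
            · exact (WithBot.coe_le_coe.mp (hk k)).2
          · push Not at hb
            exact (congrArg (WithBot.map fun y => ((ωSup c).1, y))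
              (lift_sup_bot c2 hb)).le.trans bot_le
      plot := by
        rintro c g ⟨h1, o, m, hm, hdom, g', hg', he⟩
        refine ⟨o, m, hm, ?_, fun q => ((g (S.ptMap m q)).1, g' q),
          ⟨X.str.comp_plot m _ h1, hg'⟩, fun q => ?_⟩
        · rw [← hdom]
          ext p
          exact not_congr WithBot.map_eq_bot_iff
        · exact congrArg (WithBot.map fun y => ((g (S.ptMap m q)).1, y)) (he q) }

/-! ### The fixed point combinator -/

/-- The `n`-th approximation `φ ↦ φⁿ(⊥)` of the fixed point combinator. -/
noncomputable def fixApprox (M : AdmissibleMonos S) (X Y : OmegaConc.{u, v, w} S) :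
    ℕ → Hom (expObj (expObj X (liftObj M Y)) (expObj X (liftObj M Y))) (expObj X (liftObj M Y))
  | 0 => const _ (const X (Y := liftObj M Y) (⊥ : WithBot Y.carrier))
  | n + 1 => (eval _ _).comp (pair (Hom.id _) (fixApprox M X Y n))

theorem fixApprox_le_succ (M : AdmissibleMonos S) (X Y : OmegaConc.{u, v, w} S) (n : ℕ) :
    fixApprox M X Y n ≤ fixApprox M X Y (n + 1) := by
  induction n with
  | zero => exact fun φ x => (bot_le : (⊥ : WithBot Y.carrier) ≤ _)
  | succ n ih => exact fun φ => (Hom.isHom φ).cont.monotone (ih φ)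

/-- The fixed point combinator `φ ↦ ⨆ₙ φⁿ(⊥)`. -/
noncomputable def fix (M : AdmissibleMonos S) (X Y : OmegaConc.{u, v, w} S) :
    Hom (expObj (expObj X (liftObj M Y)) (expObj X (liftObj M Y))) (expObj X (liftObj M Y)) :=
  ωSup ⟨⟨fixApprox M X Y, monotone_nat_of_le_succ (fixApprox_le_succ M X Y)⟩⟩

end Hom

end Lifting

/-! ### The language -/

/-- Ground types: `nat` and the type constants. -/
inductive Ground (A : Type a) : Type a
  | nat : Ground A
  | const : A → Ground A

/-- Types. -/
inductive Ty (A : Type a) : Type a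
  | ground : Ground A → Ty A
  | arr : Ty A → Ty A → Ty A

/-- The set of values of a ground type, given the sets of values of the type constants. -/
def GroundVal {A : Type a} (Val : A → Type w) : Ground A → Type w
  | .nat => ULift.{w} ℕ
  | .const α => Val α

/-- Extra type constants with their sets of values, and extra term constants `f : α → β` between
ground types with the associated partial functions. -/
structure Signature where
  TyConst : Type a
  Val : TyConst → Type w
  Fn : Type b
  dom : Fn → Ground TyConst
  cod : Fn → Ground TyConst
  fnEval : ∀ f : Fn, GroundVal Val (dom f) → Option (GroundVal Val (cod f))

/-- The two syntactic classes of terms: values and computations. -/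
inductive Kind
  | val
  | comp

/-- Variables (de Bruijn indices) of a given type in a context. -/
inductive Var {A : Type a} : List (Ty A) → Ty A → Type a
  | zero {Γ : List (Ty A)} {τ : Ty A} : Var (τ :: Γ) τ
  | succ {Γ : List (Ty A)} {τ σ : Ty A} : Var Γ τ → Var (σ :: Γ) τ

/-- Typing derivations of values (`Term .val Γ τ`) and computations (`Term .comp Γ τ`).  The last
variable of a context is the head of the list; in the body of `recFun` the variable of index `0` is
the argument and the variable of index `1` is the function itself. -/
inductive Term (Sg : Signature.{w, a, b}) :
    Kind → List (Ty Sg.TyConst) → Ty Sg.TyConst → Type (max w a b)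
  | var {Γ : List (Ty Sg.TyConst)} {τ : Ty Sg.TyConst} : Var Γ τ → Term Sg .val Γ τ
  | zero {Γ : List (Ty Sg.TyConst)} : Term Sg .val Γ (.ground .nat)
  | succ {Γ : List (Ty Sg.TyConst)} :
      Term Sg .val Γ (.ground .nat) → Term Sg .val Γ (.ground .nat)
  | valConst {Γ : List (Ty Sg.TyConst)} {α : Sg.TyConst} :
      Sg.Val α → Term Sg .val Γ (.ground (.const α))
  | fnConst {Γ : List (Ty Sg.TyConst)} (f : Sg.Fn) :
      Term Sg .val Γ (.arr (.ground (Sg.dom f)) (.ground (Sg.cod f)))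
  | recFun {Γ : List (Ty Sg.TyConst)} {σ τ : Ty Sg.TyConst} :
      Term Sg .comp (σ :: .arr σ τ :: Γ) τ → Term Sg .val Γ (.arr σ τ)
  | app {Γ : List (Ty Sg.TyConst)} {σ τ : Ty Sg.TyConst} :
      Term Sg .val Γ (.arr σ τ) → Term Sg .val Γ σ → Term Sg .comp Γ τ
  | ret {Γ : List (Ty Sg.TyConst)} {τ : Ty Sg.TyConst} : Term Sg .val Γ τ → Term Sg .comp Γ τ
  | letIn {Γ : List (Ty Sg.TyConst)} {σ τ : Ty Sg.TyConst} :
      Term Sg .comp Γ σ → Term Sg .comp (σ :: Γ) τ → Term Sg .comp Γ τ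
  | caseNat {Γ : List (Ty Sg.TyConst)} {τ : Ty Sg.TyConst} :
      Term Sg .val Γ (.ground .nat) → Term Sg .comp Γ τ →
        Term Sg .comp (.ground .nat :: Γ) τ → Term Sg .comp Γ τ

namespace Term

variable {Sg : Signature.{w, a, b}}

/-- Extend a renaming under a binder. -/
def extRen {Γ Δ : List (Ty Sg.TyConst)} (ρ : ∀ ⦃τ⦄, Var Γ τ → Var Δ τ) (σ : Ty Sg.TyConst) :
    ∀ ⦃τ⦄, Var (σ :: Γ) τ → Var (σ :: Δ) τ
  | _, .zero => .zero
  | _, .succ x => .succ (ρ x)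

/-- Renaming. -/
def rename {k : Kind} {Γ : List (Ty Sg.TyConst)} {τ : Ty Sg.TyConst} (t : Term Sg k Γ τ) :
    ∀ {Δ : List (Ty Sg.TyConst)}, (∀ ⦃τ⦄, Var Γ τ → Var Δ τ) → Term Sg k Δ τ :=
  match t with
  | .var x => fun ρ => .var (ρ x)
  | .zero => fun _ => .zero
  | .succ t => fun ρ => .succ (t.rename ρ)
  | .valConst c => fun _ => .valConst c
  | .fnConst f => fun _ => .fnConst f
  | .recFun t => fun ρ => .recFun (t.rename (extRen (extRen ρ _) _))
  | .app s t => fun ρ => .app (s.rename ρ) (t.rename ρ)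
  | .ret t => fun ρ => .ret (t.rename ρ)
  | .letIn s t => fun ρ => .letIn (s.rename ρ) (t.rename (extRen ρ _))
  | .caseNat r s t => fun ρ => .caseNat (r.rename ρ) (s.rename ρ) (t.rename (extRen ρ _))

/-- Extend a substitution under a binder. -/
def extSubst {Γ Δ : List (Ty Sg.TyConst)} (θ : ∀ ⦃τ⦄, Var Γ τ → Term Sg .val Δ τ)
    (σ : Ty Sg.TyConst) : ∀ ⦃τ⦄, Var (σ :: Γ) τ → Term Sg .val (σ :: Δ) τ
  | _, .zero => .var .zero
  | _, .succ x => (θ x).rename fun _ y => .succ y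

/-- Simultaneous (capture-avoiding) substitution of values for variables. -/
def subst {k : Kind} {Γ : List (Ty Sg.TyConst)} {τ : Ty Sg.TyConst} (t : Term Sg k Γ τ) :
    ∀ {Δ : List (Ty Sg.TyConst)}, (∀ ⦃τ⦄, Var Γ τ → Term Sg .val Δ τ) → Term Sg k Δ τ :=
  match t with
  | .var x => fun θ => θ x
  | .zero => fun _ => .zero
  | .succ t => fun θ => .succ (t.subst θ)
  | .valConst c => fun _ => .valConst c
  | .fnConst f => fun _ => .fnConst f
  | .recFun t => fun θ => .recFun (t.subst (extSubst (extSubst θ _) _))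
  | .app s t => fun θ => .app (s.subst θ) (t.subst θ)
  | .ret t => fun θ => .ret (t.subst θ)
  | .letIn s t => fun θ => .letIn (s.subst θ) (t.subst (extSubst θ _))
  | .caseNat r s t => fun θ => .caseNat (r.subst θ) (s.subst θ) (t.subst (extSubst θ _))

/-- The substitution `[v/x]` for the variable of index `0`. -/
def inst1 {Γ : List (Ty Sg.TyConst)} {σ : Ty Sg.TyConst} (v : Term Sg .val Γ σ) :
    ∀ ⦃τ⦄, Var (σ :: Γ) τ → Term Sg .val Γ τ
  | _, .zero => v
  | _, .succ x => .var x

/-- The substitution `[u/f, v/x]` for the variables of index `1` and `0`. -/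
def inst2 {Γ : List (Ty Sg.TyConst)} {σ σ' : Ty Sg.TyConst} (u : Term Sg .val Γ σ')
    (v : Term Sg .val Γ σ) : ∀ ⦃τ⦄, Var (σ :: σ' :: Γ) τ → Term Sg .val Γ τ
  | _, .zero => v
  | _, .succ x => inst1 u x

/-- The numeral `succⁿ 0`. -/
def numeral {Γ : List (Ty Sg.TyConst)} : ℕ → Term Sg .val Γ (.ground .nat)
  | 0 => .zero
  | n + 1 => .succ (numeral n)

/-- The closed value of ground type named by an element of the set of values of that type. -/
def quote : ∀ g : Ground Sg.TyConst, GroundVal Sg.Val g → Term Sg .val [] (.ground g)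
  | .nat, n => numeral (ULift.down.{w} n)
  | .const _, c => .valConst c

end Term

open Term in
/-- Big-step evaluation `t ⇓ v` of closed computations to closed values. -/
inductive BigStep {Sg : Signature.{w, a, b}} :
    ∀ {τ : Ty Sg.TyConst}, Term Sg .comp [] τ → Term Sg .val [] τ → Prop
  | ret {τ : Ty Sg.TyConst} (v : Term Sg .val [] τ) : BigStep (.ret v) v
  | app {σ τ : Ty Sg.TyConst} (t : Term Sg .comp [σ, .arr σ τ] τ) (v : Term Sg .val [] σ)
      (w : Term Sg .val [] τ) :
      BigStep (t.subst (inst2 (.recFun t) v)) w → BigStep (.app (.recFun t) v) w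
  | letIn {σ τ : Ty Sg.TyConst} (t : Term Sg .comp [] σ) (t' : Term Sg .comp [σ] τ)
      (v : Term Sg .val [] σ) (w : Term Sg .val [] τ) :
      BigStep t v → BigStep (t'.subst (inst1 v)) w → BigStep (.letIn t t') w
  | caseZero {τ : Ty Sg.TyConst} (t : Term Sg .comp [] τ) (t' : Term Sg .comp [.ground .nat] τ)
      (w : Term Sg .val [] τ) : BigStep t w → BigStep (.caseNat .zero t t') w
  | caseSucc {τ : Ty Sg.TyConst} (v : Term Sg .val [] (.ground .nat)) (t : Term Sg .comp [] τ)
      (t' : Term Sg .comp [.ground .nat] τ) (w : Term Sg .val [] τ) :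
      BigStep (t'.subst (inst1 v)) w → BigStep (.caseNat (.succ v) t t') w
  | fnApp (f : Sg.Fn) (x : GroundVal Sg.Val (Sg.dom f)) (y : GroundVal Sg.Val (Sg.cod f)) :
      Sg.fnEval f x = some y →
        BigStep (.app (.fnConst f) (quote (Sg.dom f) x)) (quote (Sg.cod f) y)

/-! ### Denotational semantics -/

section Denotation

variable {C : Type u} [Category.{v} C] {S : ConcreteSite C}

/-- The interpretation of ground types, given ω-concrete sheaf structures on the sets of values of
the type constants. -/
def groundStr {A : Type a} {Val : A → Type w} (str : ∀ α : A, OmegaConcStr S (Val α)) :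
    ∀ g : Ground A, OmegaConcStr S (GroundVal Val g)
  | .nat => (natObj S).str
  | .const α => str α

def groundObj {A : Type a} {Val : A → Type w} (str : ∀ α : A, OmegaConcStr S (Val α))
    (g : Ground A) : OmegaConc.{u, v, w} S where
  carrier := GroundVal Val g
  str := groundStr str g

/-- A partial function, as a total function into `Y ⊎ {⊥}`. -/
def toLift {X Y : Type w} (f : X → Option Y) : X → WithBot Y :=
  fun x => (f x).elim ⊥ WithBot.some

/-- An interpretation of the constants of `Sg`: ω-concrete sheaf structures on the sets of values of
the type constants, such that every term constant is a partial morphism. -/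
structure Interp (M : AdmissibleMonos S) (Sg : Signature.{w, a, b}) where
  str : ∀ α : Sg.TyConst, OmegaConcStr S (Sg.Val α)
  fn_isHom : ∀ f : Sg.Fn, IsHom (groundObj str (Sg.dom f)) (liftObj M (groundObj str (Sg.cod f)))
    (toLift (Sg.fnEval f))

variable {M : AdmissibleMonos S} {Sg : Signature.{w, a, b}} (I : Interp M Sg)

namespace Interp

/-- The interpretation of types. -/
noncomputable def tyObj : Ty Sg.TyConst → OmegaConc.{u, v, w} S
  | .ground g => groundObj I.str g
  | .arr σ τ => expObj (tyObj σ) (liftObj M (tyObj τ))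

/-- The interpretation of contexts. -/
noncomputable def ctxObj : List (Ty Sg.TyConst) → OmegaConc.{u, v, w} S
  | [] => unitObj S
  | τ :: Γ => prodObj (ctxObj Γ) (I.tyObj τ)

/-- Values of type `τ` are interpreted in `⟦τ⟧`, computations in `L_M ⟦τ⟧`. -/
noncomputable def kindObj : Kind → Ty Sg.TyConst → OmegaConc.{u, v, w} S
  | .val, τ => I.tyObj τ
  | .comp, τ => liftObj M (I.tyObj τ)

/-- The interpretation of variables as projections. -/
noncomputable def denVar : ∀ {Γ : List (Ty Sg.TyConst)} {τ : Ty Sg.TyConst},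
    Var Γ τ → Hom (I.ctxObj Γ) (I.tyObj τ)
  | _, _, .zero => Hom.snd _ _
  | _, _, .succ x => (denVar x).comp (Hom.fst _ _)

/-- The morphism interpreting a term constant. -/
noncomputable def fnHom (f : Sg.Fn) :
    Hom (groundObj I.str (Sg.dom f)) (liftObj M (groundObj I.str (Sg.cod f))) :=
  ⟨_, I.fn_isHom f⟩

/-- The interpretation of values and computations. -/
noncomputable def den : ∀ {k : Kind} {Γ : List (Ty Sg.TyConst)} {τ : Ty Sg.TyConst},
    Term Sg k Γ τ → Hom (I.ctxObj Γ) (I.kindObj k τ)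
  | _, _, _, .var x => I.denVar x
  | _, _, _, .zero => Hom.const _ (Y := natObj S) (ULift.up 0)
  | _, _, _, .succ t => (Hom.succ S).comp (den t)
  | _, _, _, .valConst (α := α) c => Hom.const _ (Y := groundObj I.str (.const α)) c
  | _, _, _, .fnConst f =>
      Hom.const _ (Y := I.tyObj (.arr (.ground (Sg.dom f)) (.ground (Sg.cod f)))) (I.fnHom f)
  | _, _, _, .recFun (σ := σ) (τ := τ) t =>
      (Hom.fix M (I.tyObj σ) (I.tyObj τ)).comp (Hom.curry (Hom.curry (den t)))
  | _, _, _, .app (σ := σ) (τ := τ) s t =>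
      (Hom.eval (I.tyObj σ) (liftObj M (I.tyObj τ))).comp (Hom.pair (den s) (den t))
  | _, _, _, .ret (τ := τ) t => (Hom.unit M (I.tyObj τ)).comp (den t)
  | _, Γ, _, .letIn (σ := σ) (τ := τ) s t =>
      (Hom.mul M (I.tyObj τ)).comp ((Hom.lmap M (den t)).comp
        ((Hom.strength M (I.ctxObj Γ) (I.tyObj σ)).comp (Hom.pair (Hom.id _) (den s))))
  | _, _, _, .caseNat r s t => (Hom.natCase (den s) (den t)).comp (Hom.pair (Hom.id _) (den r))

end Interp

end Denotation

end OmegaPCF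

namespace OmegaPCF

/-! ### Syntax: renaming and substitution -/

namespace Term

variable {Sg : Signature.{w, a, b}}

/-! The argument takes place on underlying ω-cpos. The site and the admissible monos are needed to
make the interpretation well defined: once `den` is built, two morphisms agree as soon as they agree
on elements, and the lifting is the ordinary `X ⊎ {⊥}`.

Soundness is an induction on the evaluation derivation. The substitution lemma `den_subst` turns
each instantiated body into the body evaluated in an extended environment, and `Hom.fix_eq` accounts
for the unfolding of a recursive function.

Adequacy uses a logical relation between elements of the model and closed terms. At ground type the
value names the element; at function type related arguments go to related computations; a
computation is related to `⊥` unconditionally, and to an element `y` when it evaluates to a value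
related to `y`. The fundamental lemma `rel_subst` says that every term, closed by values related to
its environment, is related to its denotation. Its only difficult case is recursion: the
approximations `φⁿ(⊥)` are related to the recursive function by induction on `n`, and the relation
passes to their supremum by `RelVal.sup`.

That closure under suprema rests on `BigStep.deterministic`: each stage of a chain yields some
resulting value, and determinism forces these values to coincide, so that the supremum can be
compared with a single value. At ground type the fundamental lemma gives adequacy, because there
being related is an equality of closed values. -/

theorem subst_rename {k : Kind} {Γ : List (Ty Sg.TyConst)} {τ : Ty Sg.TyConst}
    (t : Term Sg k Γ τ) : ∀ {Δ Θ : List (Ty Sg.TyConst)} (ρ : ∀ ⦃τ⦄, Var Γ τ → Var Δ τ)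
      (θ : ∀ ⦃τ⦄, Var Δ τ → Term Sg .val Θ τ) (η : ∀ ⦃τ⦄, Var Γ τ → Term Sg .val Θ τ),
      (∀ ⦃τ⦄ (x : Var Γ τ), θ (ρ x) = η x) → (t.rename ρ).subst θ = t.subst η := by
  -- The composite is kept as a separate map `η` with a pointwise hypothesis. Going under a binder
  -- then only requires transporting that hypothesis to the extended maps, which is what `ext` does;
  -- the later fusion lemmas follow the same pattern.
  have ext : ∀ {Γ Δ Θ : List (Ty Sg.TyConst)} {ρ : ∀ ⦃τ⦄, Var Γ τ → Var Δ τ}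
      {θ : ∀ ⦃τ⦄, Var Δ τ → Term Sg .val Θ τ} {η : ∀ ⦃τ⦄, Var Γ τ → Term Sg .val Θ τ}
      (σ : Ty Sg.TyConst), (∀ ⦃τ⦄ (x : Var Γ τ), θ (ρ x) = η x) →
      ∀ ⦃τ⦄ (x : Var (σ :: Γ) τ), extSubst θ σ (extRen ρ σ x) = extSubst η σ x := by
    intro Γ Δ Θ ρ θ η σ h τ x
    cases x with
    | zero => rfl
    | succ x => simp only [extRen, extSubst, h]
  induction t with
  | var x => intro Δ Θ ρ θ η h; exact h x
  | zero => intros; rfl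
  | succ t ih => intro Δ Θ ρ θ η h; simp only [rename, subst, ih ρ θ η h]
  | valConst c => intros; rfl
  | fnConst f => intros; rfl
  | recFun t ih =>
    intro Δ Θ ρ θ η h
    simp only [rename, subst, ih _ _ _ (ext _ (ext _ h))]
  | app s t ihs iht =>
    intro Δ Θ ρ θ η h
    simp only [rename, subst, ihs ρ θ η h, iht ρ θ η h]
  | ret t ih => intro Δ Θ ρ θ η h; simp only [rename, subst, ih ρ θ η h]
  | letIn s t ihs iht =>
    intro Δ Θ ρ θ η h
    simp only [rename, subst, ihs ρ θ η h, iht _ _ _ (ext _ h)]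
  | caseNat r s t ihr ihs iht =>
    intro Δ Θ ρ θ η h
    simp only [rename, subst, ihr ρ θ η h, ihs ρ θ η h, iht _ _ _ (ext _ h)]

theorem rename_rename {k : Kind} {Γ : List (Ty Sg.TyConst)} {τ : Ty Sg.TyConst}
    (t : Term Sg k Γ τ) : ∀ {Δ Θ : List (Ty Sg.TyConst)} (ρ : ∀ ⦃τ⦄, Var Γ τ → Var Δ τ)
      (θ : ∀ ⦃τ⦄, Var Δ τ → Var Θ τ) (η : ∀ ⦃τ⦄, Var Γ τ → Var Θ τ),
      (∀ ⦃τ⦄ (x : Var Γ τ), θ (ρ x) = η x) → (t.rename ρ).rename θ = t.rename η := by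
  have ext : ∀ {Γ Δ Θ : List (Ty Sg.TyConst)} {ρ : ∀ ⦃τ⦄, Var Γ τ → Var Δ τ}
      {θ : ∀ ⦃τ⦄, Var Δ τ → Var Θ τ} {η : ∀ ⦃τ⦄, Var Γ τ → Var Θ τ}
      (σ : Ty Sg.TyConst), (∀ ⦃τ⦄ (x : Var Γ τ), θ (ρ x) = η x) →
      ∀ ⦃τ⦄ (x : Var (σ :: Γ) τ), extRen θ σ (extRen ρ σ x) = extRen η σ x := by
    intro Γ Δ Θ ρ θ η σ h τ x
    cases x with
    | zero => rfl
    | succ x => simp only [extRen, h]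
  induction t with
  | var x => intro Δ Θ ρ θ η h; exact congrArg Term.var (h x)
  | zero => intros; rfl
  | succ t ih => intro Δ Θ ρ θ η h; simp only [rename, ih ρ θ η h]
  | valConst c => intros; rfl
  | fnConst f => intros; rfl
  | recFun t ih =>
    intro Δ Θ ρ θ η h
    simp only [rename, ih _ _ _ (ext _ (ext _ h))]
  | app s t ihs iht =>
    intro Δ Θ ρ θ η h
    simp only [rename, ihs ρ θ η h, iht ρ θ η h]
  | ret t ih => intro Δ Θ ρ θ η h; simp only [rename, ih ρ θ η h]
  | letIn s t ihs iht =>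
    intro Δ Θ ρ θ η h
    simp only [rename, ihs ρ θ η h, iht _ _ _ (ext _ h)]
  | caseNat r s t ihr ihs iht =>
    intro Δ Θ ρ θ η h
    simp only [rename, ihr ρ θ η h, ihs ρ θ η h, iht _ _ _ (ext _ h)]

theorem rename_subst {k : Kind} {Γ : List (Ty Sg.TyConst)} {τ : Ty Sg.TyConst}
    (t : Term Sg k Γ τ) : ∀ {Δ Θ : List (Ty Sg.TyConst)}
      (θ : ∀ ⦃τ⦄, Var Γ τ → Term Sg .val Δ τ) (ρ : ∀ ⦃τ⦄, Var Δ τ → Var Θ τ)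
      (η : ∀ ⦃τ⦄, Var Γ τ → Term Sg .val Θ τ),
      (∀ ⦃τ⦄ (x : Var Γ τ), (θ x).rename ρ = η x) → (t.subst θ).rename ρ = t.subst η := by
  have ext : ∀ {Γ Δ Θ : List (Ty Sg.TyConst)} {θ : ∀ ⦃τ⦄, Var Γ τ → Term Sg .val Δ τ}
      {ρ : ∀ ⦃τ⦄, Var Δ τ → Var Θ τ} {η : ∀ ⦃τ⦄, Var Γ τ → Term Sg .val Θ τ}
      (σ : Ty Sg.TyConst), (∀ ⦃τ⦄ (x : Var Γ τ), (θ x).rename ρ = η x) →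
      ∀ ⦃τ⦄ (x : Var (σ :: Γ) τ), (extSubst θ σ x).rename (extRen ρ σ) = extSubst η σ x := by
    intro Γ Δ Θ θ ρ η σ h τ x
    cases x with
    | zero => rfl
    | succ x =>
      simp only [extSubst, ← h]
      -- Both sides apply `ρ` to `θ x` and weaken by the new variable, in opposite orders; each is
      -- the single renaming `y ↦ succ (ρ y)`.
      exact (rename_rename (θ x) _ (extRen ρ σ) (fun _ y => .succ (ρ y)) fun _ _ => rfl).trans
        (rename_rename (θ x) ρ (fun _ y => .succ y) _ fun _ _ => rfl).symm
  induction t with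
  | var x => intro Δ Θ θ ρ η h; exact h x
  | zero => intros; rfl
  | succ t ih => intro Δ Θ θ ρ η h; simp only [rename, subst, ih θ ρ η h]
  | valConst c => intros; rfl
  | fnConst f => intros; rfl
  | recFun t ih =>
    intro Δ Θ θ ρ η h
    simp only [rename, subst, ih _ _ _ (ext _ (ext _ h))]
  | app s t ihs iht =>
    intro Δ Θ θ ρ η h
    simp only [rename, subst, ihs θ ρ η h, iht θ ρ η h]
  | ret t ih => intro Δ Θ θ ρ η h; simp only [rename, subst, ih θ ρ η h]
  | letIn s t ihs iht =>
    intro Δ Θ θ ρ η h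
    simp only [rename, subst, ihs θ ρ η h, iht _ _ _ (ext _ h)]
  | caseNat r s t ihr ihs iht =>
    intro Δ Θ θ ρ η h
    simp only [rename, subst, ihr θ ρ η h, ihs θ ρ η h, iht _ _ _ (ext _ h)]

theorem subst_subst {k : Kind} {Γ : List (Ty Sg.TyConst)} {τ : Ty Sg.TyConst}
    (t : Term Sg k Γ τ) : ∀ {Δ Θ : List (Ty Sg.TyConst)}
      (θ : ∀ ⦃τ⦄, Var Γ τ → Term Sg .val Δ τ) (ρ : ∀ ⦃τ⦄, Var Δ τ → Term Sg .val Θ τ)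
      (η : ∀ ⦃τ⦄, Var Γ τ → Term Sg .val Θ τ),
      (∀ ⦃τ⦄ (x : Var Γ τ), (θ x).subst ρ = η x) → (t.subst θ).subst ρ = t.subst η := by
  have ext : ∀ {Γ Δ Θ : List (Ty Sg.TyConst)} {θ : ∀ ⦃τ⦄, Var Γ τ → Term Sg .val Δ τ}
      {ρ : ∀ ⦃τ⦄, Var Δ τ → Term Sg .val Θ τ} {η : ∀ ⦃τ⦄, Var Γ τ → Term Sg .val Θ τ}
      (σ : Ty Sg.TyConst), (∀ ⦃τ⦄ (x : Var Γ τ), (θ x).subst ρ = η x) →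
      ∀ ⦃τ⦄ (x : Var (σ :: Γ) τ), (extSubst θ σ x).subst (extSubst ρ σ) = extSubst η σ x := by
    intro Γ Δ Θ θ ρ η σ h τ x
    cases x with
    | zero => rfl
    | succ x =>
      simp only [extSubst, ← h]
      exact (subst_rename _ _ _ _ fun _ _ => rfl).trans
        (rename_subst _ _ _ _ fun _ _ => rfl).symm
  induction t with
  | var x => intro Δ Θ θ ρ η h; exact h x
  | zero => intros; rfl
  | succ t ih => intro Δ Θ θ ρ η h; simp only [subst, ih θ ρ η h]
  | valConst c => intros; rfl
  | fnConst f => intros; rfl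
  | recFun t ih =>
    intro Δ Θ θ ρ η h
    simp only [subst, ih _ _ _ (ext _ (ext _ h))]
  | app s t ihs iht =>
    intro Δ Θ θ ρ η h
    simp only [subst, ihs θ ρ η h, iht θ ρ η h]
  | ret t ih => intro Δ Θ θ ρ η h; simp only [subst, ih θ ρ η h]
  | letIn s t ihs iht =>
    intro Δ Θ θ ρ η h
    simp only [subst, ihs θ ρ η h, iht _ _ _ (ext _ h)]
  | caseNat r s t ihr ihs iht =>
    intro Δ Θ θ ρ η h
    simp only [subst, ihr θ ρ η h, ihs θ ρ η h, iht _ _ _ (ext _ h)]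

theorem subst_eq_self {k : Kind} {Γ : List (Ty Sg.TyConst)} {τ : Ty Sg.TyConst}
    (t : Term Sg k Γ τ) : ∀ (θ : ∀ ⦃τ⦄, Var Γ τ → Term Sg .val Γ τ),
      (∀ ⦃τ⦄ (x : Var Γ τ), θ x = .var x) → t.subst θ = t := by
  have ext : ∀ {Γ : List (Ty Sg.TyConst)} {θ : ∀ ⦃τ⦄, Var Γ τ → Term Sg .val Γ τ}
      (σ : Ty Sg.TyConst), (∀ ⦃τ⦄ (x : Var Γ τ), θ x = .var x) →
      ∀ ⦃τ⦄ (x : Var (σ :: Γ) τ), extSubst θ σ x = .var x := by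
    intro Γ θ σ h τ x
    cases x with
    | zero => rfl
    | succ x => simp only [extSubst, h, rename]
  induction t with
  | var x => intro θ h; exact h x
  | zero => intros; rfl
  | succ t ih => intro θ h; simp only [subst, ih θ h]
  | valConst c => intros; rfl
  | fnConst f => intros; rfl
  | recFun t ih => intro θ h; simp only [subst, ih _ (ext _ (ext _ h))]
  | app s t ihs iht => intro θ h; simp only [subst, ihs θ h, iht θ h]
  | ret t ih => intro θ h; simp only [subst, ih θ h]
  | letIn s t ihs iht => intro θ h; simp only [subst, ihs θ h, iht _ (ext _ h)]
  | caseNat r s t ihr ihs iht =>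
    intro θ h
    simp only [subst, ihr θ h, ihs θ h, iht _ (ext _ h)]

/-- Extend a closing substitution by a closed value. -/
def consSubst {Γ Δ : List (Ty Sg.TyConst)} {σ : Ty Sg.TyConst}
    (θ : ∀ ⦃τ⦄, Var Γ τ → Term Sg .val Δ τ) (v : Term Sg .val Δ σ) :
    ∀ ⦃τ⦄, Var (σ :: Γ) τ → Term Sg .val Δ τ
  | _, .zero => v
  | _, .succ x => θ x

/-- Evaluation instantiates a body that has already been closed under its binder, whereas the
fundamental lemma works with one extended closing substitution; this identifies the two. On old
variables the weakening made by `extSubst` is undone by `inst1 v`. -/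
theorem subst_extSubst_inst1 {k : Kind} {Γ Δ : List (Ty Sg.TyConst)} {σ τ : Ty Sg.TyConst}
    (t : Term Sg k (σ :: Γ) τ) (θ : ∀ ⦃τ⦄, Var Γ τ → Term Sg .val Δ τ) (v : Term Sg .val Δ σ) :
    (t.subst (extSubst θ σ)).subst (inst1 v) = t.subst (consSubst θ v) := by
  apply subst_subst
  intro τ x
  cases x with
  | zero => rfl
  | succ x =>
    exact (subst_rename _ _ _ _ fun _ _ => rfl).trans (subst_eq_self _ _ fun _ _ => rfl)

theorem subst_extSubst_inst2 {k : Kind} {Γ Δ : List (Ty Sg.TyConst)} {σ σ' τ : Ty Sg.TyConst}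
    (t : Term Sg k (σ :: σ' :: Γ) τ) (θ : ∀ ⦃τ⦄, Var Γ τ → Term Sg .val Δ τ)
    (u : Term Sg .val Δ σ') (v : Term Sg .val Δ σ) :
    (t.subst (extSubst (extSubst θ σ') σ)).subst (inst2 u v) =
      t.subst (consSubst (consSubst θ u) v) := by
  apply subst_subst
  intro τ x
  cases x with
  | zero => rfl
  | succ x =>
    -- The outer weakening skips the variable that receives `v`, so what remains of `inst2 u v` is
    -- `inst1 u`.
    refine (subst_rename _ _ (inst2 u v) (inst1 u) fun _ _ => rfl).trans ?_
    cases x with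
    | zero => rfl
    | succ x =>
      exact (subst_rename _ _ _ _ fun _ _ => rfl).trans (subst_eq_self _ _ fun _ _ => rfl)

/-! ### Names of ground values -/

theorem numeral_injective {Γ : List (Ty Sg.TyConst)} :
    Function.Injective (numeral (Sg := Sg) (Γ := Γ)) := by
  intro m
  induction m with
  | zero =>
    intro n (h : Term.zero = _)
    cases n with
    | zero => rfl
    | succ n => exact nomatch (h : Term.zero = .succ (numeral n))
  | succ m ih =>
    intro n (h : Term.succ (numeral m) = _)
    cases n with
    | zero => exact nomatch (h : Term.succ (numeral m) = .zero)
    | succ n => exact congrArg _ (ih (Term.succ.inj h))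

/-- Used twice: an argument of a term constant determines the element at which its partial function
is taken, and a chain of elements with a common name is constant. -/
theorem quote_injective : ∀ g : Ground Sg.TyConst, Function.Injective (quote (Sg := Sg) g)
  | .nat, _, _, h => ULift.down_injective (numeral_injective h)
  | .const _, _, _, h => Term.valConst.inj h

end Term

/-! ### Evaluation is deterministic -/

open Term in
/-- The premises under which a closed computation evaluates to a given closed value. -/
def BigStep.Premises {Sg : Signature.{w, a, b}} :
    ∀ {τ : Ty Sg.TyConst}, Term Sg .comp [] τ → Term Sg .val [] τ → Prop
  | _, .ret v, w => w = v
  | _, .app (.recFun t) v, w => BigStep (t.subst (inst2 (.recFun t) v)) w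
  | _, .app (.fnConst f) v, w => ∃ x y, Sg.fnEval f x = some y ∧ v = quote (Sg.dom f) x ∧
      w = quote (Sg.cod f) y
  | _, .app (.var x) _, _ => nomatch x
  | _, .letIn t t', w => ∃ v, BigStep t v ∧ BigStep (t'.subst (inst1 v)) w
  | _, .caseNat .zero t _, w => BigStep t w
  | _, .caseNat (.succ v) _ t', w => BigStep (t'.subst (inst1 v)) w
  | _, .caseNat (.var x) _ _, _ => nomatch x

/-- Inversion for evaluation. Case analysis is done here with the term and value still variables, so
the indices `quote (Sg.dom f) x`, which are not constructor applications, raise no unification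
problem. -/
theorem BigStep.premises {Sg : Signature.{w, a, b}} {τ : Ty Sg.TyConst} {t : Term Sg .comp [] τ}
    {v : Term Sg .val [] τ} (h : BigStep t v) : BigStep.Premises t v := by
  cases h with
  | ret v => exact rfl
  | app t v w h => exact h
  | letIn t t' v w h h' => exact ⟨v, h, h'⟩
  | caseZero t t' w h => exact h
  | caseSucc v t t' w h => exact h
  | fnApp f x y h => exact ⟨x, y, h, rfl, rfl⟩

theorem BigStep.deterministic {Sg : Signature.{w, a, b}} {τ : Ty Sg.TyConst}
    {t : Term Sg .comp [] τ} {v v' : Term Sg .val [] τ} (h : BigStep t v) (h' : BigStep t v') :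
    v = v' := by
  induction h with
  | ret v => exact Eq.symm h'.premises
  | app t v w h ih => exact ih h'.premises
  | letIn t t' v w h1 h2 ih1 ih2 =>
    obtain ⟨u, hu, hu'⟩ := h'.premises
    -- The bound computations must agree on their value before the two evaluations of the body can
    -- be compared.
    obtain rfl := ih1 hu
    exact ih2 hu'
  | caseZero t t' w h ih => exact ih h'.premises
  | caseSucc v t t' w h ih => exact ih h'.premises
  | fnApp f x y h =>
    obtain ⟨x', y', he, hx, rfl⟩ := h'.premises
    obtain rfl := Term.quote_injective _ hx
    rw [h] at he
    rw [Option.some.inj he]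

/-! ### Fixed points -/

section Semantics

variable {C : Type u} [Category.{v} C] {S : ConcreteSite C} {M : AdmissibleMonos S}

theorem Hom.le_fix {X Y : OmegaConc.{u, v, w} S} (n : ℕ)
    (φ : Hom (expObj X (liftObj M Y)) (expObj X (liftObj M Y))) :
    (Hom.fixApprox M X Y n).toFun φ ≤ (Hom.fix M X Y).toFun φ :=
  le_ωSup (Chain.map ⟨⟨Hom.fixApprox M X Y, monotone_nat_of_le_succ (Hom.fixApprox_le_succ M X Y)⟩⟩
    (Hom.evalAt φ)) n

theorem Hom.fix_eq {X Y : OmegaConc.{u, v, w} S}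
    (φ : Hom (expObj X (liftObj M Y)) (expObj X (liftObj M Y))) :
    (Hom.fix M X Y).toFun φ = φ.toFun ((Hom.fix M X Y).toFun φ) := by
  apply le_antisymm
  · refine ωSup_le _ _ fun n => ?_
    cases n with
    | zero => exact fun x => (bot_le : (⊥ : WithBot Y.carrier) ≤ _)
    | succ n => exact φ.isHom.cont.monotone (Hom.le_fix n φ)
  -- By continuity it suffices to bound `φ` of the `n`-th approximation, which is by definition the
  -- approximation of index `n + 1`.
  · exact cont_le φ.isHom.cont _ _ fun n => Hom.le_fix (n + 1) φ

/-! ### Semantics of renaming and substitution -/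

namespace Interp

variable {Sg : Signature.{w, a, b}} (I : Interp M Sg)

/-! ### Pointwise equations for the denotation -/

theorem den_recFun {Γ : List (Ty Sg.TyConst)} {σ τ : Ty Sg.TyConst}
    (t : Term Sg .comp (σ :: .arr σ τ :: Γ) τ) (γ : (I.ctxObj Γ).carrier) :
    (I.den (.recFun t)).toFun γ = (Hom.fix M (I.tyObj σ) (I.tyObj τ)).toFun
      ((Hom.curry (Hom.curry (I.den t))).toFun γ) := rfl

theorem den_app {Γ : List (Ty Sg.TyConst)} {σ τ : Ty Sg.TyConst}
    (s : Term Sg .val Γ (.arr σ τ)) (t : Term Sg .val Γ σ) (γ : (I.ctxObj Γ).carrier) :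
    (I.den (.app s t)).toFun γ =
      Hom.toFun (X := I.tyObj σ) (Y := liftObj M (I.tyObj τ)) ((I.den s).toFun γ)
        ((I.den t).toFun γ) := rfl

/-- Together with `den_letIn_bot`, this computes the composite of strength, functorial action and
multiplication as Kleisli extension: it reduces only once the bound computation is known to be an
element or `⊥`. -/
theorem den_letIn_coe {Γ : List (Ty Sg.TyConst)} {σ τ : Ty Sg.TyConst}
    (s : Term Sg .comp Γ σ) (t : Term Sg .comp (σ :: Γ) τ) (γ : (I.ctxObj Γ).carrier)
    (x : (I.tyObj σ).carrier) (h : (I.den s).toFun γ = WithBot.some x) :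
    (I.den (.letIn s t)).toFun γ = (I.den t).toFun (γ, x) := by
  change (Hom.mul M (I.tyObj τ)).toFun ((Hom.lmap M (I.den t)).toFun
        ((Hom.strength M (I.ctxObj Γ) (I.tyObj σ)).toFun (γ, (I.den s).toFun γ))) = _
  rw [h]
  rfl

theorem den_letIn_bot {Γ : List (Ty Sg.TyConst)} {σ τ : Ty Sg.TyConst}
    (s : Term Sg .comp Γ σ) (t : Term Sg .comp (σ :: Γ) τ) (γ : (I.ctxObj Γ).carrier)
    (h : (I.den s).toFun γ = (⊥ : WithBot (I.tyObj σ).carrier)) :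
    (I.den (.letIn s t)).toFun γ = (⊥ : WithBot (I.tyObj τ).carrier) := by
  change (Hom.mul M (I.tyObj τ)).toFun ((Hom.lmap M (I.den t)).toFun
        ((Hom.strength M (I.ctxObj Γ) (I.tyObj σ)).toFun (γ, (I.den s).toFun γ))) = _
  rw [h]
  rfl

/-- The denotation depends only on the values of the denotations of the subterms, even across
different contexts. This and the two congruences below serve the binding cases of both `den_rename`
and `den_subst`. -/
theorem den_letIn_congr {Γ Δ : List (Ty Sg.TyConst)} {σ τ : Ty Sg.TyConst}
    {s : Term Sg .comp Γ σ} {t : Term Sg .comp (σ :: Γ) τ} {γ : (I.ctxObj Γ).carrier}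
    {s' : Term Sg .comp Δ σ} {t' : Term Sg .comp (σ :: Δ) τ} {δ : (I.ctxObj Δ).carrier}
    (hs : (I.den s').toFun δ = (I.den s).toFun γ)
    (ht : ∀ x : (I.tyObj σ).carrier, (I.den t').toFun (δ, x) = (I.den t).toFun (γ, x)) :
    (I.den (.letIn s' t')).toFun δ = (I.den (.letIn s t)).toFun γ := by
  by_cases h : (I.den s).toFun γ = (⊥ : WithBot (I.tyObj σ).carrier)
  · rw [I.den_letIn_bot s t γ h]
    exact I.den_letIn_bot _ _ _ (hs.trans h)
  · obtain ⟨x, hx⟩ := WithBot.ne_bot_iff_exists.mp h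
    rw [I.den_letIn_coe s t γ x hx.symm, I.den_letIn_coe s' t' δ x (hs.trans hx.symm)]
    exact ht x

theorem den_caseNat {Γ : List (Ty Sg.TyConst)} {τ : Ty Sg.TyConst}
    (r : Term Sg .val Γ (.ground .nat)) (s : Term Sg .comp Γ τ)
    (t : Term Sg .comp (.ground .nat :: Γ) τ) (γ : (I.ctxObj Γ).carrier) :
    (I.den (.caseNat r s t)).toFun γ =
      Hom.natCaseFun (I.den s) (I.den t) γ ((I.den r).toFun γ) := rfl

theorem den_caseNat_congr {Γ Δ : List (Ty Sg.TyConst)} {τ : Ty Sg.TyConst}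
    {r : Term Sg .val Γ (.ground .nat)} {s : Term Sg .comp Γ τ}
    {t : Term Sg .comp (.ground .nat :: Γ) τ} {γ : (I.ctxObj Γ).carrier}
    {r' : Term Sg .val Δ (.ground .nat)} {s' : Term Sg .comp Δ τ}
    {t' : Term Sg .comp (.ground .nat :: Δ) τ} {δ : (I.ctxObj Δ).carrier}
    (hr : (I.den r').toFun δ = (I.den r).toFun γ) (hs : (I.den s').toFun δ = (I.den s).toFun γ)
    (ht : ∀ x : (I.tyObj (.ground .nat)).carrier,
      (I.den t').toFun (δ, x) = (I.den t).toFun (γ, x)) :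
    (I.den (.caseNat r' s' t')).toFun δ = (I.den (.caseNat r s t)).toFun γ := by
  rw [den_caseNat, den_caseNat, hr]
  generalize (I.den r).toFun γ = n
  obtain ⟨n⟩ : ULift ℕ := n
  cases n with
  | zero => exact hs
  | succ n => exact ht _

theorem den_recFun_congr {Γ Δ : List (Ty Sg.TyConst)} {σ τ : Ty Sg.TyConst}
    {t : Term Sg .comp (σ :: .arr σ τ :: Γ) τ} {γ : (I.ctxObj Γ).carrier}
    {t' : Term Sg .comp (σ :: .arr σ τ :: Δ) τ} {δ : (I.ctxObj Δ).carrier}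
    (ht : ∀ (f : (I.tyObj (.arr σ τ)).carrier) (x : (I.tyObj σ).carrier),
      (I.den t').toFun ((δ, f), x) = (I.den t).toFun ((γ, f), x)) :
    (I.den (.recFun t')).toFun δ = (I.den (.recFun t)).toFun γ := by
  rw [den_recFun, den_recFun]
  -- The two endomorphisms fed to the fixed point combinator are equal by extensionality in `f` and
  -- `x`.
  refine congrArg _ (Hom.ext (funext fun f => Hom.ext (funext fun x => ht f x)))

/-- The renaming is compared with the denotation through a pair of compatible environments, so it
never has to be interpreted as a morphism of contexts. -/
theorem den_rename {k : Kind} {Γ : List (Ty Sg.TyConst)} {τ : Ty Sg.TyConst}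
    (t : Term Sg k Γ τ) : ∀ {Δ : List (Ty Sg.TyConst)} (ρ : ∀ ⦃τ⦄, Var Γ τ → Var Δ τ)
      (γ : (I.ctxObj Γ).carrier) (δ : (I.ctxObj Δ).carrier),
      (∀ ⦃τ⦄ (x : Var Γ τ), (I.denVar (ρ x)).toFun δ = (I.denVar x).toFun γ) →
      (I.den (t.rename ρ)).toFun δ = (I.den t).toFun γ := by
  have ext : ∀ {Γ Δ : List (Ty Sg.TyConst)} {ρ : ∀ ⦃τ⦄, Var Γ τ → Var Δ τ}
      {γ : (I.ctxObj Γ).carrier} {δ : (I.ctxObj Δ).carrier} (σ : Ty Sg.TyConst)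
      (y : (I.tyObj σ).carrier),
      (∀ ⦃τ⦄ (x : Var Γ τ), (I.denVar (ρ x)).toFun δ = (I.denVar x).toFun γ) →
      ∀ ⦃τ⦄ (x : Var (σ :: Γ) τ),
        (I.denVar (Term.extRen ρ σ x)).toFun (δ, y) = (I.denVar x).toFun (γ, y) := by
    intro Γ Δ ρ γ δ σ y h τ x
    cases x with
    | zero => rfl
    | succ x => exact h x
  induction t with
  | var x => intro Δ ρ γ δ h; exact h x
  | zero => intros; rfl
  | succ t ih => intro Δ ρ γ δ h; exact congrArg (Hom.succ S).toFun (ih ρ γ δ h)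
  | valConst c => intros; rfl
  | fnConst f => intros; rfl
  | recFun t ih =>
    intro Δ ρ γ δ h
    exact I.den_recFun_congr fun f x => ih _ _ _ (ext _ x (ext _ f h))
  | app s t ihs iht =>
    intro Δ ρ γ δ h
    rw [den_app, ← ihs ρ γ δ h, ← iht ρ γ δ h]
    rfl
  | ret t ih => intro Δ ρ γ δ h; exact congrArg WithBot.some (ih ρ γ δ h)
  | letIn s t ihs iht =>
    intro Δ ρ γ δ h
    exact I.den_letIn_congr (ihs ρ γ δ h) fun x => iht _ _ _ (ext _ x h)
  | caseNat r s t ihr ihs iht =>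
    intro Δ ρ γ δ h
    exact I.den_caseNat_congr (ihr ρ γ δ h) (ihs ρ γ δ h) fun x => iht _ _ _ (ext _ x h)

theorem den_subst {k : Kind} {Γ : List (Ty Sg.TyConst)} {τ : Ty Sg.TyConst}
    (t : Term Sg k Γ τ) : ∀ {Δ : List (Ty Sg.TyConst)} (θ : ∀ ⦃τ⦄, Var Γ τ → Term Sg .val Δ τ)
      (γ : (I.ctxObj Γ).carrier) (δ : (I.ctxObj Δ).carrier),
      (∀ ⦃τ⦄ (x : Var Γ τ), (I.den (θ x)).toFun δ = (I.denVar x).toFun γ) →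
      (I.den (t.subst θ)).toFun δ = (I.den t).toFun γ := by
  have ext : ∀ {Γ Δ : List (Ty Sg.TyConst)} {θ : ∀ ⦃τ⦄, Var Γ τ → Term Sg .val Δ τ}
      {γ : (I.ctxObj Γ).carrier} {δ : (I.ctxObj Δ).carrier} (σ : Ty Sg.TyConst)
      (y : (I.tyObj σ).carrier),
      (∀ ⦃τ⦄ (x : Var Γ τ), (I.den (θ x)).toFun δ = (I.denVar x).toFun γ) →
      ∀ ⦃τ⦄ (x : Var (σ :: Γ) τ),
        (I.den (Term.extSubst θ σ x)).toFun (δ, y) = (I.denVar x).toFun (γ, y) := by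
    intro Γ Δ θ γ δ σ y h τ x
    cases x with
    | zero => rfl
    -- A weakened value ignores the new coordinate `y` of the environment.
    | succ x => exact (I.den_rename (θ x) (Δ := σ :: Δ) _ δ (δ, y) fun _ _ => rfl).trans (h x)
  induction t with
  | var x => intro Δ θ γ δ h; exact h x
  | zero => intros; rfl
  | succ t ih => intro Δ θ γ δ h; exact congrArg (Hom.succ S).toFun (ih θ γ δ h)
  | valConst c => intros; rfl
  | fnConst f => intros; rfl
  | recFun t ih =>
    intro Δ θ γ δ h
    exact I.den_recFun_congr fun f x => ih _ _ _ (ext _ x (ext _ f h))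
  | app s t ihs iht =>
    intro Δ θ γ δ h
    rw [den_app, ← ihs θ γ δ h, ← iht θ γ δ h]
    rfl
  | ret t ih => intro Δ θ γ δ h; exact congrArg WithBot.some (ih θ γ δ h)
  | letIn s t ihs iht =>
    intro Δ θ γ δ h
    exact I.den_letIn_congr (ihs θ γ δ h) fun x => iht _ _ _ (ext _ x h)
  | caseNat r s t ihr ihs iht =>
    intro Δ θ γ δ h
    exact I.den_caseNat_congr (ihr θ γ δ h) (ihs θ γ δ h) fun x => iht _ _ _ (ext _ x h)

theorem den_inst1 {Γ : List (Ty Sg.TyConst)} {k : Kind} {σ τ : Ty Sg.TyConst}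
    (t : Term Sg k (σ :: Γ) τ) (v : Term Sg .val Γ σ) (γ : (I.ctxObj Γ).carrier) :
    (I.den (t.subst (Term.inst1 v))).toFun γ = (I.den t).toFun (γ, (I.den v).toFun γ) := by
  apply den_subst
  intro τ x
  cases x <;> rfl

theorem den_inst2 {Γ : List (Ty Sg.TyConst)} {k : Kind} {σ σ' τ : Ty Sg.TyConst}
    (t : Term Sg k (σ :: σ' :: Γ) τ) (u : Term Sg .val Γ σ') (v : Term Sg .val Γ σ)
    (γ : (I.ctxObj Γ).carrier) :
    (I.den (t.subst (Term.inst2 u v))).toFun γ =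
      (I.den t).toFun ((γ, (I.den u).toFun γ), (I.den v).toFun γ) := by
  apply den_subst
  intro τ x
  cases x with
  | zero => rfl
  | succ x => cases x <;> rfl

theorem den_quote : ∀ (g : Ground Sg.TyConst) (x : GroundVal Sg.Val g)
    (γ : (I.ctxObj []).carrier), (I.den (Term.quote g x)).toFun γ = x
  | .nat, ⟨n⟩, γ => by
    induction n with
    | zero => rfl
    | succ n ih => exact congrArg (Hom.succ S).toFun ih
  | .const _, _, _ => rfl

/-- Closed values of ground type are named by their denotation. -/
theorem quote_den {g : Ground Sg.TyConst} (v : Term Sg .val [] (.ground g))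
    (γ : (I.ctxObj []).carrier) : Term.quote g ((I.den v).toFun γ) = v :=
  match g, v with
  | _, .var x => nomatch x
  | _, .zero => rfl
  | _, .succ v => congrArg Term.succ (quote_den v γ)
  | _, .valConst _ => rfl

/-! ### Soundness -/

theorem sound {τ : Ty Sg.TyConst} {t : Term Sg .comp [] τ} {v : Term Sg .val [] τ}
    (h : BigStep t v) (γ : (I.ctxObj []).carrier) :
    (I.den t).toFun γ = (WithBot.some ((I.den v).toFun γ) : WithBot (I.tyObj τ).carrier) := by
  induction h with
  | ret v => rfl
  | app t v w h ih =>
    rw [← ih, den_inst2, den_app]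
    -- One unfolding of the fixed point is one evaluation step: the body is applied to the recursive
    -- function and its argument.
    exact congrFun (congrArg Hom.toFun (Hom.fix_eq
      ((Hom.curry (Hom.curry (I.den t))).toFun γ))) _
  | letIn t t' v w h h' ih ih' => rw [← ih', den_inst1, I.den_letIn_coe _ _ _ _ ih]
  | caseZero t t' w h ih => exact ih
  | caseSucc v t t' w h ih =>
    rw [← ih, den_inst1]
    rfl
  | fnApp f x y h =>
    rw [den_app, den_quote, den_quote]
    -- The constant denotes its partial function with undefinedness sent to `⊥`.
    change (Sg.fnEval f x).elim ⊥ WithBot.some = _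
    rw [h]
    rfl

/-! ### The logical relation -/

/-- The relation between elements of `⟦τ⟧` and closed values of type `τ`. -/
def RelVal : ∀ τ : Ty Sg.TyConst, (I.tyObj τ).carrier → Term Sg .val [] τ → Prop
  | .ground g, x, v => v = Term.quote g x
  -- The conclusion is the relation for computations between `f x` and `.app u v`, written out so
  -- that the recursion on types stays structural; divergence of `f x` demands nothing.
  | .arr σ τ, f, u => ∀ (x : (I.tyObj σ).carrier) (v : Term Sg .val [] σ), RelVal σ x v →
      ∀ y : (I.tyObj τ).carrier,
        Hom.toFun (X := I.tyObj σ) (Y := liftObj M (I.tyObj τ)) f x = WithBot.some y →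
          ∃ v', BigStep (.app u v) v' ∧ RelVal τ y v'

/-- The relation between elements of `L_M ⟦τ⟧` and closed computations of type `τ`. -/
def RelComp (τ : Ty Sg.TyConst) (d : WithBot (I.tyObj τ).carrier) (t : Term Sg .comp [] τ) :
    Prop :=
  ∀ y : (I.tyObj τ).carrier, d = WithBot.some y → ∃ v, BigStep t v ∧ I.RelVal τ y v

/-- The relation between the denotations and the closed terms of either kind. -/
def Rel : ∀ (k : Kind) (τ : Ty Sg.TyConst), (I.kindObj k τ).carrier → Term Sg k [] τ → Prop
  | .val, τ => I.RelVal τ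
  | .comp, τ => I.RelComp τ

/-- Closure for values of type `τ` is a hypothesis because `RelVal.sup` calls this lemma at the
codomain of an arrow while recursing on types. -/
theorem RelComp.sup {τ : Ty Sg.TyConst}
    (hτ : ∀ (c : Chain (I.tyObj τ).carrier) (v : Term Sg .val [] τ),
      (∀ n, I.RelVal τ (c n) v) → I.RelVal τ (ωSup c) v)
    (c : Chain (WithBot (I.tyObj τ).carrier)) (t : Term Sg .comp [] τ)
    (h : ∀ n, I.RelComp τ (c n) t) : I.RelComp τ (ωSup c) t := by
  intro y hy
  obtain ⟨n, hn⟩ := (lift_sup_ne_bot c).mp (hy ▸ WithBot.coe_ne_bot)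
  rw [lift_sup_eq c n hn] at hy
  obtain rfl := WithBot.coe_injective hy
  -- The first element of the chain different from `⊥` in the chosen tail supplies the candidate
  -- value for the supremum.
  obtain ⟨v, hv, -⟩ := h (n + 0) _ (coe_liftTail c n hn 0).symm
  refine ⟨v, hv, hτ _ _ fun k => ?_⟩
  obtain ⟨v', hv', hr⟩ := h (n + k) _ (coe_liftTail c n hn k).symm
  -- Each later stage comes with its own value `v'`; determinism identifies it with `v`.
  rwa [hv.deterministic hv']

theorem RelVal.sup : ∀ (τ : Ty Sg.TyConst) (c : Chain (I.tyObj τ).carrier)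
    (v : Term Sg .val [] τ), (∀ n, I.RelVal τ (c n) v) → I.RelVal τ (ωSup c) v
  | .ground g, c, v, h => by
    -- The order on a type constant is arbitrary, but all elements of the chain are named by the
    -- same `v`, so the chain is constant.
    have hc : ∀ n, c n = c 0 := fun n =>
      Term.quote_injective g ((h n).symm.trans (h 0))
    have : ωSup c = c 0 := le_antisymm (ωSup_le _ _ fun n => (hc n).le) (le_ωSup c 0)
    rw [this]
    exact h 0
  | .arr σ τ, c, u, h => fun x v hx =>
    RelComp.sup I (RelVal.sup τ)
      (Chain.map (α := Hom (I.tyObj σ) (liftObj M (I.tyObj τ))) c (Hom.evalAt x)) (.app u v)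
      fun n => h n x v hx

/-- The fundamental lemma of the logical relation. -/
theorem rel_subst {k : Kind} {Γ : List (Ty Sg.TyConst)} {τ : Ty Sg.TyConst}
    (t : Term Sg k Γ τ) : ∀ (θ : ∀ ⦃τ⦄, Var Γ τ → Term Sg .val [] τ) (γ : (I.ctxObj Γ).carrier),
      (∀ ⦃τ⦄ (x : Var Γ τ), I.RelVal τ ((I.denVar x).toFun γ) (θ x)) →
      I.Rel k τ ((I.den t).toFun γ) (t.subst θ) := by
  have cons : ∀ {Γ : List (Ty Sg.TyConst)} {θ : ∀ ⦃τ⦄, Var Γ τ → Term Sg .val [] τ}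
      {γ : (I.ctxObj Γ).carrier} {σ : Ty Sg.TyConst} {y : (I.tyObj σ).carrier}
      {v : Term Sg .val [] σ}, I.RelVal σ y v →
      (∀ ⦃τ⦄ (x : Var Γ τ), I.RelVal τ ((I.denVar x).toFun γ) (θ x)) →
      ∀ ⦃τ⦄ (x : Var (σ :: Γ) τ),
        I.RelVal τ ((I.denVar x).toFun (γ, y)) (Term.consSubst θ v x) := by
    intro Γ θ γ σ y v hy h τ x
    cases x with
    | zero => exact hy
    | succ x => exact h x
  induction t with
  | var x => intro θ γ h; exact h x
  | zero => intro θ γ h; exact rfl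
  | succ t ih => intro θ γ h; exact congrArg Term.succ (ih θ γ h)
  | valConst c => intro θ γ h; exact rfl
  | fnConst f =>
    rintro θ γ h x v rfl y hy
    change (Sg.fnEval f x).elim ⊥ WithBot.some = _ at hy
    refine ⟨Term.quote _ y, BigStep.fnApp f x y ?_, rfl⟩
    cases hf : Sg.fnEval f x with
    | none =>
      rw [hf] at hy
      exact (WithBot.bot_ne_coe hy).elim
    | some z =>
      rw [hf] at hy
      exact congrArg some (WithBot.coe_injective hy)
  | @recFun Γ σ τ t ih =>
    intro θ γ h
    -- Every approximation is related to the same closed term, the full recursive function; its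
    -- fixed point is then handled as a supremum.
    have approx : ∀ n, I.RelVal (.arr σ τ) ((Hom.fixApprox M (I.tyObj σ) (I.tyObj τ) n).toFun
        ((Hom.curry (Hom.curry (I.den t))).toFun γ)) ((Term.recFun t).subst θ) := by
      intro n
      induction n with
      | zero => exact fun x v _ y hy => (WithBot.bot_ne_coe hy).elim
      | succ n ihn =>
        intro x v hx y hy
        -- The next approximation at `x` is the body evaluated at the previous approximation and
        -- `x`, so the hypothesis on the body applies with the recursive function itself substituted
        -- for its variable.
        obtain ⟨v', hv', hr⟩ := ih _ _ (cons hx (cons ihn h)) y hy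
        refine ⟨v', BigStep.app _ _ _ ?_, hr⟩
        rw [Term.subst_extSubst_inst2]
        exact hv'
    exact RelVal.sup I (.arr σ τ) _ _ approx
  -- The relation at arrow type was defined to be exactly this case.
  | app s t ihs iht => intro θ γ h; exact ihs θ γ h _ _ (iht θ γ h)
  | ret t ih =>
    intro θ γ h y hy
    obtain rfl := WithBot.coe_injective hy
    exact ⟨_, BigStep.ret _, ih θ γ h⟩
  | @letIn Γ σ τ s t ihs iht =>
    intro θ γ h y hy
    by_cases hs : (I.den s).toFun γ = (⊥ : WithBot (I.tyObj σ).carrier)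
    · exact (WithBot.bot_ne_coe ((I.den_letIn_bot s t γ hs).symm.trans hy)).elim
    · obtain ⟨x, hx⟩ := WithBot.ne_bot_iff_exists.mp hs
      obtain ⟨v, hv, hr⟩ := ihs θ γ h x hx.symm
      obtain ⟨v', hv', hr'⟩ := iht _ _ (cons hr h) y
        ((I.den_letIn_coe s t γ x hx.symm).symm.trans hy)
      refine ⟨v', BigStep.letIn _ _ _ _ hv ?_, hr'⟩
      rw [Term.subst_extSubst_inst1]
      exact hv'
  | caseNat r s t ihr ihs iht =>
    intro θ γ h y hy
    -- At `nat` the relation is an equality, so the closed scrutinee is the numeral of its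
    -- denotation, and one case split on `n` decides both the evaluation rule and the branch of the
    -- denotation.
    have hr : r.subst θ = Term.quote .nat ((I.den r).toFun γ) := ihr θ γ h
    rw [den_caseNat] at hy
    change ∃ v, BigStep (.caseNat (r.subst θ) (s.subst θ) (t.subst (Term.extSubst θ _))) v ∧ _
    rw [hr]
    generalize (I.den r).toFun γ = n at hy
    obtain ⟨n⟩ : ULift ℕ := n
    cases n with
    | zero =>
      obtain ⟨v, hv, hr⟩ := ihs θ γ h y hy
      exact ⟨v, BigStep.caseZero _ _ _ hv, hr⟩
    | succ n =>
      obtain ⟨v, hv, hr⟩ := iht (Term.consSubst θ (Term.numeral n)) (γ, ULift.up n)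
        (cons (σ := .ground .nat) rfl h) y hy
      refine ⟨v, BigStep.caseSucc _ _ _ _ ?_, hr⟩
      rw [Term.subst_extSubst_inst1]
      exact hv

/-- The fundamental lemma at the empty context gives some value `v'` of `t` related to the
denotation of `v`. Only at ground type does this force `v' = v`, since there a closed value is
recovered from its denotation by `quote_den`. -/
theorem adequate {g : Ground Sg.TyConst} {t : Term Sg .comp [] (.ground g)}
    {v : Term Sg .val [] (.ground g)} (h : I.den t = I.den (.ret v)) : BigStep t v := by
  obtain ⟨v', hv', hr⟩ := I.rel_subst t (fun _ x => .var x) PUnit.unit (fun _ x => nomatch x)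
    ((I.den v).toFun PUnit.unit) (by rw [h]; rfl)
  have hv : v' = v := hr.trans (I.quote_den v PUnit.unit)
  rw [Term.subst_eq_self t _ fun _ _ => rfl] at hv'
  rwa [hv] at hv'

end Interp

end Semantics

end OmegaPCF

/-! ### Soundness and adequacy -/

theorem mainTheorem2 {C : Type u} [Category.{v} C] (S : OmegaPCF.ConcreteSite C)
    (M : OmegaPCF.AdmissibleMonos S) (Sg : OmegaPCF.Signature.{w, a, b})
    (I : OmegaPCF.Interp M Sg) :
    (∀ (τ : OmegaPCF.Ty Sg.TyConst) (t : OmegaPCF.Term Sg .comp [] τ)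
        (v : OmegaPCF.Term Sg .val [] τ),
      OmegaPCF.BigStep t v → I.den t = I.den (.ret v)) ∧
    (∀ (g : OmegaPCF.Ground Sg.TyConst) (t : OmegaPCF.Term Sg .comp [] (.ground g))
        (v : OmegaPCF.Term Sg .val [] (.ground g)),
      I.den t = I.den (.ret v) → OmegaPCF.BigStep t v) :=
  ⟨fun _ _ _ h => OmegaPCF.Hom.ext (funext fun γ => I.sound h γ), fun _ _ _ h => I.adequate h⟩
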